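/- Let $\mathcal S\subset\mathbb R^3$ be the unit sphere with surface measure $\sigma$ and outer unit normal $\vec e_r(x)=x$. Let $\nabla_{\mathcal S}$ and $\Delta_{\mathcal S}$ be the surface gradient and the Laplace--Beltrami operator of $\mathcal S$, and let $\underline{\mathrm{curl}}_{\mathcal S} f=\nabla_{\mathcal S}f\times\vec e_r$ be the vectorial surface rotation, i.e. $\underline{\mathrm{curl}}_{\mathcal S} f=-\partial_\theta f\,\vec e_\varphi+\frac1{\sin\theta}\partial_\varphi f\,\vec e_\theta$ in spherical coordinates. Let $\mathcal C\subset\mathcal S$ be a simple closed regular curve of class $C^1$ which divides $\mathcal S$ into two disjoint open parts, $\mathcal S\setminus\mathcal C=\mathcal S_1\cup\mathcal S_2$, with $\partial\mathcal S_1=\partial\mathcal S_2=\mathcal C$. Let $\mathcal C$ be positively oriented as the boundary of $\mathcal S_2$, i.e. its unit tangent vector $\vec t$ is such that $\vec e_r\times\vec t$ points into $\mathcal S_2$, and let $ds$ be its arc length element. For $x\ne x_0$ in $\mathcal S$ put $$U^*(x,x_0)=-\frac1{4\pi}\log\bigl(1-\langle x,x_0\rangle\bigr).$$ Let $u\in C^2(\mathcal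 S_2)\cap C^1(\overline{\mathcal S_2})$ be such that $\Delta_{\mathcal S}u$ is integrable over $\mathcal S_2$. Then for every $x_0\in\mathcal S\setminus\mathcal C$ the function $U^*(\cdot,x_0)\,\Delta_{\mathcal S}u$ is integrable over $\mathcal S_2$, and $$\frac1{4\pi}\int_{\mathcal S_2}u\,d\sigma-\int_{\mathcal S_2}U^*(x,x_0)\,\Delta_{\mathcal S}u(x)\,d\sigma_x-\int_{\mathcal C}U^*(x,x_0)\,\underline{\mathrm{curl}}_{\mathcal S}u(x)\cdot\vec t(x)\,ds_x+\int_{\mathcal C}u(x)\,\underline{\mathrm{curl}}_{\mathcal S}U^*(x,x_0)\cdot\vec t(x)\,ds_x=\begin{cases}u(x_0)&\text{if }x_0\in\mathcal S_2,\\0&\text{if }x_0\in\mathcal S_1=\mathcal S\setminus\overline{\mathcal S_2}.\end{cases}$$ Here the values of $\underline{\mathrm{curl}}_{\mathcal S}u$ on $\mathcal C$ are those of its continuous extension from $\mathcal S_2$, and the curl of $U^*(x,x_0)$ is taken with respect to $x$. -/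

import Mathlib

open MeasureTheory Set Filter Topology
open scoped Manifold RealInnerProductSpace

noncomputable section

namespace SphereRepr

/-- Euclidean three-space. -/
abbrev E3 : Type := EuclideanSpace ℝ (Fin 3)

/-- The unit sphere in `E3`, with Mathlib's topology, manifold structure and Borel structure. -/
abbrev Sph : Type := Metric.sphere (0 : E3) 1

/-- The surface measure of the unit sphere (of total mass `4π`). -/
def area : Measure Sph := (volume : Measure E3).toSphere

/-- The cross product of `E3`. -/
def cross (v w : E3) : E3 := WithLp.toLp 2 (crossProduct v.ofLp w.ofLp)

/-- The radial projection `y ↦ y / |y|` onto the sphere (the value at `0` is irrelevant). -/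
def radial (y : E3) : Sph :=
  if h : y ≠ 0 then ⟨‖y‖⁻¹ • y, by simp [norm_smul, h]⟩
  else ⟨EuclideanSpace.single 0 1, by simp⟩

/-- The extension of a function on the sphere that is constant on rays from the origin. -/
def homExt (f : Sph → ℝ) (y : E3) : ℝ := f (radial y)

/-- The surface gradient `∇_S f`: on the sphere it is the Euclidean gradient of the extension of
`f` that is constant on rays. In spherical coordinates it is
`(1 / sin θ) ∂_φ f e_φ + ∂_θ f e_θ`. -/
def surfGrad (f : Sph → ℝ) (x : Sph) : E3 := gradient (homExt f) (x : E3)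

/-- The vectorial surface rotation `curl_S f = ∇_S f × e_r`, where `e_r` is the outer unit normal
of the sphere. In spherical coordinates it is `- ∂_θ f e_φ + (1 / sin θ) ∂_φ f e_θ`. -/
def surfCurl (f : Sph → ℝ) (x : Sph) : E3 := cross (surfGrad f x) (x : E3)

/-- The Laplace-Beltrami operator of the sphere: on the sphere it is the Euclidean Laplacian of the
extension of `f` that is constant on rays. -/
def laplaceBeltrami (f : Sph → ℝ) (x : Sph) : ℝ :=
  Laplacian.laplacian (homExt f) (x : E3)

/-- The fundamental solution `U*(x, x₀) = -(1 / 4π) log (1 - ⟨x, x₀⟩)`. -/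
def fundSol (x x₀ : Sph) : ℝ :=
  -(1 / (4 * Real.pi)) * Real.log (1 - ⟪(x : E3), (x₀ : E3)⟫)

/-- `f ∈ C²(S)`, for an open subset `S` of the sphere. -/
def IsC2On (f : Sph → ℝ) (S : Set Sph) : Prop :=
  ContMDiffOn (𝓡 2) 𝓘(ℝ, ℝ) 2 f S

/-- `f ∈ C¹(closure S)`, for an open subset `S` of the sphere: `f` is `C¹` on `S`, and `f` and its
surface gradient extend continuously from `S` to the closure of `S`. -/
structure IsC1UpToBoundary (f : Sph → ℝ) (S : Set Sph) : Prop where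
  contMDiffOn : ContMDiffOn (𝓡 2) 𝓘(ℝ, ℝ) 1 f S
  continuousOn : ContinuousOn f (closure S)
  exists_grad : ∃ G : Sph → E3, ContinuousOn G (closure S) ∧ EqOn G (surfGrad f) S

/-- The continuous extension of `curl_S f` from `S` to the closure of `S`. -/
def boundaryCurl (f : Sph → ℝ) (S : Set Sph) : Sph → E3 :=
  extendFrom S (surfCurl f)

/-- The velocity vector of a curve on the sphere. -/
def velocity (γ : ℝ → Sph) (s : ℝ) : E3 := deriv (fun r => (γ r : E3)) s

/-- The unit tangent vector of a curve on the sphere. -/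
def unitTangent (γ : ℝ → Sph) (s : ℝ) : E3 := ‖velocity γ s‖⁻¹ • velocity γ s

/-- `γ`, run through once over a period `L`, is a simple closed regular curve of class `C¹`. -/
structure IsSimpleClosedCurve (γ : ℝ → Sph) (L : ℝ) : Prop where
  pos : 0 < L
  contDiff : ContDiff ℝ 1 (fun s => (γ s : E3))
  periodic : Function.Periodic γ L
  injOn : InjOn γ (Ico 0 L)
  velocity_ne_zero : ∀ s, velocity γ s ≠ 0

/-- The curve `γ` divides the sphere into the two parts `S₁` and `S₂`, and is their common
boundary. -/
structure Divides (γ : ℝ → Sph) (S₁ S₂ : Set Sph) : Prop where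
  isOpen₁ : IsOpen S₁
  isOpen₂ : IsOpen S₂
  disjoint : Disjoint S₁ S₂
  union : S₁ ∪ S₂ = (range γ)ᶜ
  frontier₁ : frontier S₁ = range γ
  frontier₂ : frontier S₂ = range γ

/-- The curve `γ` is positively oriented as the boundary of `S`, in the sense of Stokes' theorem
with respect to the outer normal `e_r` of the sphere: `S` lies to the left of `γ`, that is, the
direction `e_r × t` points from the curve into `S`. -/
def PositivelyOriented (γ : ℝ → Sph) (S : Set Sph) : Prop :=
  ∀ s, ∀ᶠ ε in 𝓝[>] (0 : ℝ),
    radial ((γ s : E3) + ε • cross (γ s : E3) (unitTangent γ s)) ∈ S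

/-- The line integral `∫_C V · t ds` along the closed curve `γ` of period `L`. -/
def lineIntegral (γ : ℝ → Sph) (L : ℝ) (V : Sph → E3) : ℝ :=
  ∫ s in (0 : ℝ)..L, ⟪V (γ s), unitTangent γ s⟫ * ‖velocity γ s‖

/-- The left-hand side of the representation formula. -/
def reprLHS (γ : ℝ → Sph) (L : ℝ) (S : Set Sph) (u : Sph → ℝ) (x₀ : Sph) : ℝ :=
  1 / (4 * Real.pi) * (∫ x in S, u x ∂area)
    - (∫ x in S, fundSol x x₀ * laplaceBeltrami u x ∂area)
    - lineIntegral γ L (fun x => fundSol x x₀ • boundaryCurl u S x)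
    + lineIntegral γ L (fun x => u x • surfCurl (fun y => fundSol y x₀) x)

end SphereRepr

end

/-!
The surface divergence of a tangential field on the sphere is computed on *patches*, the images of
ruled surfaces `c s + t n` under the radial projection, where it is the curl of the pulled back flux
form. Along `γ` one takes `c = γ` and for `n` the left normal at a point of `γ`, so that the patch
straightens the curve; since `γ` is only `C¹`, no better chart is available. The fundamental theorem
of calculus on a rectangle and a partition of unity give the divergence theorem on `S₂`, and
hence Green's second identity.

The fundamental solution is approached from the smooth side, by
`-(1 / 4π) log (1 + ε - ⟨x, x₀⟩)`: its Laplacian is `1 / 4π - K_ε` with an approximate identity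
`K_ε ≥ 0`, so that Green's identity tends to the representation formula as `ε → 0`. No small disc
around `x₀` has to be cut out.
-/

noncomputable section

namespace SphereRepr

/-! ### The radial projection -/

lemma norm_coe_sph (x : Sph) : ‖(x : E3)‖ = 1 := by simp

lemma coe_sph_ne_zero (x : Sph) : (x : E3) ≠ 0 :=
  ne_zero_of_mem_unit_sphere x

lemma inner_self_sph (x : Sph) : ⟪(x : E3), (x : E3)⟫ = 1 := by
  rw [real_inner_self_eq_norm_sq, norm_coe_sph, one_pow]

lemma coe_radial {y : E3} (hy : y ≠ 0) : (radial y : E3) = ‖y‖⁻¹ • y := by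
  simp [radial, hy]

lemma norm_smul_radial {y : E3} (hy : y ≠ 0) : ‖y‖ • (radial y : E3) = y := by
  rw [coe_radial hy, smul_inv_smul₀ (norm_ne_zero_iff.2 hy)]

lemma radial_smul_coe {r : ℝ} (hr : 0 < r) (x : Sph) : radial (r • (x : E3)) = x := by
  apply Subtype.ext
  rw [coe_radial (smul_ne_zero hr.ne' (coe_sph_ne_zero x)), norm_smul, norm_coe_sph, mul_one,
    Real.norm_of_nonneg hr.le, inv_smul_smul₀ hr.ne']

lemma radial_coe (x : Sph) : radial (x : E3) = x := by
  simpa using radial_smul_coe one_pos x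

lemma radial_smul {r : ℝ} (hr : 0 < r) {y : E3} (hy : y ≠ 0) : radial (r • y) = radial y := by
  conv_lhs => rw [← norm_smul_radial hy, smul_smul]
  exact radial_smul_coe (mul_pos hr (norm_pos_iff.2 hy)) _

lemma contDiffAt_coe_radial {m : WithTop ℕ∞} {y : E3} (hy : y ≠ 0) :
    ContDiffAt ℝ m (fun z => (radial z : E3)) y := by
  have h : ContDiffAt ℝ m (fun z : E3 => ‖z‖⁻¹ • z) y :=
    ((contDiffAt_norm ℝ hy).inv (norm_ne_zero_iff.2 hy)).smul contDiffAt_id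
  refine h.congr_of_eventuallyEq ?_
  filter_upwards [isOpen_ne.mem_nhds hy] with z hz using coe_radial hz

lemma contMDiffAt_radial {m : WithTop ℕ∞} {y : E3} (hy : y ≠ 0) :
    ContMDiffAt 𝓘(ℝ, E3) (𝓡 2) m radial y := by
  have : Fact (Module.finrank ℝ E3 = 2 + 1) := ⟨by simp⟩
  -- `ContMDiff.codRestrict_sphere` is only available for globally smooth maps.
  let V : TopologicalSpace.Opens E3 := ⟨{z | z ≠ 0}, isOpen_ne⟩
  have hV : ContMDiff 𝓘(ℝ, E3) 𝓘(ℝ, E3) m (fun z : V => (radial (z : E3) : E3)) := fun z =>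
    contMDiffAt_subtype_iff.2 (contDiffAt_coe_radial z.2).contMDiffAt
  have h : ContMDiffAt 𝓘(ℝ, E3) (𝓡 2) m (fun z : V => radial (z : E3)) ⟨y, hy⟩ :=
    hV.codRestrict_sphere (fun z => (radial (z : E3)).2) ⟨y, hy⟩
  exact contMDiffAt_subtype_iff.1 h

lemma continuousAt_radial {y : E3} (hy : y ≠ 0) : ContinuousAt radial y :=
  (contMDiffAt_radial (m := 0) hy).continuousAt

lemma continuousOn_radial : ContinuousOn radial {y : E3 | y ≠ 0} :=
  fun _ hy => (continuousAt_radial hy).continuousWithinAt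

lemma tendsto_radial_nhds_coe (x : Sph) : Tendsto radial (𝓝 (x : E3)) (𝓝 x) := by
  simpa only [radial_coe] using (continuousAt_radial (coe_sph_ne_zero x)).tendsto

lemma measurable_radial : Measurable radial := by
  have h : Measurable fun y : E3 =>
      if y ≠ 0 then ‖y‖⁻¹ • y else (EuclideanSpace.single 0 1 : E3) :=
    Measurable.ite (measurableSet_singleton (0 : E3)).compl (by fun_prop) measurable_const
  refine Measurable.subtype_mk (h := fun y => (radial y).2) (?_ : Measurable fun y => (radial y).1)
  convert h using 2 with y
  unfold radial
  split_ifs <;> rfl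

lemma map_radial_nhds {y : E3} (hy : y ≠ 0) : map radial (𝓝 y) = 𝓝 (radial y) := by
  refine le_antisymm (continuousAt_radial hy) fun s hs => ?_
  have hscale : Tendsto (fun x : Sph => ‖y‖ • (x : E3)) (𝓝 (radial y)) (𝓝 y) := by
    conv_rhs => rw [← norm_smul_radial hy]
    exact (continuous_subtype_val.const_smul ‖y‖).tendsto _
  filter_upwards [hscale hs] with x hx
  rwa [mem_preimage, mem_preimage, radial_smul_coe (norm_pos_iff.2 hy)] at hx

/-- The open cone over a subset of the sphere. It is the natural domain of the extensions of
functions and fields from that subset to space. -/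
def cone (S : Set Sph) : Set E3 := {y | y ≠ 0 ∧ radial y ∈ S}

lemma isOpen_cone {S : Set Sph} (hS : IsOpen S) : IsOpen (cone S) :=
  continuousOn_radial.isOpen_inter_preimage isOpen_ne hS

lemma coe_mem_cone {S : Set Sph} {x : Sph} : (x : E3) ∈ cone S ↔ x ∈ S := by
  simp [cone, radial_coe, coe_sph_ne_zero]

lemma homExt_coe (f : Sph → ℝ) (x : Sph) : homExt f x = f x := by
  rw [homExt, radial_coe]

lemma contDiffOn_homExt {m : WithTop ℕ∞} {f : Sph → ℝ} {S : Set Sph}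
    (hf : ContMDiffOn (𝓡 2) 𝓘(ℝ, ℝ) m f S) : ContDiffOn ℝ m (homExt f) (cone S) := by
  rw [← contMDiffOn_iff_contDiffOn]
  exact hf.comp (fun y hy => (contMDiffAt_radial hy.1).contMDiffWithinAt) fun y hy => hy.2

/-! ### Homogeneous functions -/

section Homogeneous

variable {E G : Type*} [NormedAddCommGroup E] [NormedSpace ℝ E] [NormedAddCommGroup G]
  [NormedSpace ℝ G] {F : E → G} {k : ℤ} {y : E}

/-- Euler's relation. -/
lemma fderiv_apply_self_of_homogeneous (hF : ∀ r : ℝ, 0 < r → F (r • y) = r ^ k • F y)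
    (hd : DifferentiableAt ℝ F y) : fderiv ℝ F y y = (k : ℝ) • F y := by
  have hray : HasDerivAt (fun r : ℝ => r • y) y 1 := by
    simpa using (hasDerivAt_id (1 : ℝ)).smul_const y
  have hF1 : HasFDerivAt F (fderiv ℝ F y) ((1 : ℝ) • y) := by simpa using hd.hasFDerivAt
  have hpow : HasDerivAt (fun r : ℝ => r ^ k • F y) ((k : ℝ) • F y) 1 := by
    simpa using (hasDerivAt_zpow k (1 : ℝ) (Or.inl one_ne_zero)).smul_const (F y)
  refine (hF1.comp_hasDerivAt 1 hray).unique (hpow.congr_of_eventuallyEq ?_)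
  filter_upwards [lt_mem_nhds one_pos] with r hr using hF r hr

lemma fderiv_smul_of_homogeneous {r : ℝ} (hr : r ≠ 0)
    (hF : ∀ᶠ z in 𝓝 y, F (r • z) = r ^ k • F z) :
    fderiv ℝ F (r • y) = r ^ (k - 1) • fderiv ℝ F y := by
  have h : r • fderiv ℝ F (r • y) = r ^ k • fderiv ℝ F y := by
    rw [← fderiv_comp_smul, EventuallyEq.fderiv_eq hF]
    exact congrFun (fderiv_const_smul_field (r ^ k)) y
  rw [zpow_sub_one₀ hr, mul_comm, mul_smul, ← h, inv_smul_smul₀ hr]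

end Homogeneous

/-! ### The divergence -/

section Divergence

variable {E : Type*} [NormedAddCommGroup E] [NormedSpace ℝ E]

/-- The divergence of a vector field on a normed space. -/
def divergence (F : E → E) (y : E) : ℝ := LinearMap.trace ℝ E (fderiv ℝ F y)

lemma divergence_congr {F G : E → E} {y : E} (h : F =ᶠ[𝓝 y] G) :
    divergence F y = divergence G y := by
  rw [divergence, divergence, h.fderiv_eq]

lemma divergence_const (v y : E) : divergence (fun _ => v) y = 0 := by
  simp [divergence]

lemma divergence_sub {F G : E → E} {y : E} (hF : DifferentiableAt ℝ F y)
    (hG : DifferentiableAt ℝ G y) :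
    divergence (fun z => F z - G z) y = divergence F y - divergence G y := by
  simp [divergence, fderiv_fun_sub hF hG]

lemma divergence_sum {ι : Type*} {s : Finset ι} {F : ι → E → E} {y : E}
    (hF : ∀ i ∈ s, DifferentiableAt ℝ (F i) y) :
    divergence (fun z => ∑ i ∈ s, F i z) y = ∑ i ∈ s, divergence (F i) y := by
  simp [divergence, fderiv_fun_sum hF]

lemma divergence_smul [FiniteDimensional ℝ E] {ψ : E → ℝ} {F : E → E} {y : E}
    (hψ : DifferentiableAt ℝ ψ y) (hF : DifferentiableAt ℝ F y) :
    divergence (fun z => ψ z • F z) y = ψ y * divergence F y + fderiv ℝ ψ y (F y) := by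
  rw [divergence, fderiv_fun_smul hψ hF, ContinuousLinearMap.toLinearMap_add, map_add,
    ContinuousLinearMap.toLinearMap_smul, map_smul, smul_eq_mul]
  congr 1
  exact LinearMap.trace_smulRight (fderiv ℝ ψ y : E →ₗ[ℝ] ℝ) (F y)

end Divergence

/-- The extension of a vector field on the sphere that is homogeneous of degree `-2`. In this
degree the extension of a radial field is divergence free. -/
def fieldExt (f : Sph → E3) (y : E3) : E3 := ‖y‖ ^ (-2 : ℤ) • f (radial y)

/-- The surface divergence of the tangential part of a vector field on the sphere. -/
def surfDiv (f : Sph → E3) (x : Sph) : ℝ := divergence (fieldExt f) x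

lemma fieldExt_coe (f : Sph → E3) (x : Sph) : fieldExt f x = f x := by
  simp [fieldExt, radial_coe]

lemma fieldExt_smul (f : Sph → E3) {r : ℝ} (hr : 0 < r) {y : E3} (hy : y ≠ 0) :
    fieldExt f (r • y) = r ^ (-2 : ℤ) • fieldExt f y := by
  simp only [fieldExt, radial_smul hr hy, norm_smul, Real.norm_of_nonneg hr.le, smul_smul,
    mul_zpow]

lemma fderiv_fieldExt_self {f : Sph → E3} {y : E3} (hy : y ≠ 0)
    (hf : DifferentiableAt ℝ (fieldExt f) y) :
    fderiv ℝ (fieldExt f) y y = (-2 : ℝ) • fieldExt f y := by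
  simpa using fderiv_apply_self_of_homogeneous (fun r hr => fieldExt_smul f hr hy) hf

lemma surfDiv_radial (f : Sph → E3) {y : E3} (hy : y ≠ 0) :
    surfDiv f (radial y) = ‖y‖ ^ 3 * divergence (fieldExt f) y := by
  have hr : 0 < ‖y‖⁻¹ := inv_pos.2 (norm_pos_iff.2 hy)
  have h : fderiv ℝ (fieldExt f) (‖y‖⁻¹ • y) = ‖y‖ ^ 3 • fderiv ℝ (fieldExt f) y := by
    rw [fderiv_smul_of_homogeneous hr.ne' (k := -2), inv_zpow']
    · norm_cast
    · filter_upwards [isOpen_ne.mem_nhds hy] with z hz using fieldExt_smul f hr hz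
  simp [surfDiv, divergence, coe_radial hy, h]

lemma surfDiv_congr {f g : Sph → E3} {x : Sph} (h : f =ᶠ[𝓝 x] g) :
    surfDiv f x = surfDiv g x := by
  apply divergence_congr
  filter_upwards [(tendsto_radial_nhds_coe x).eventually h] with y hy
  rw [fieldExt, hy, fieldExt]

lemma surfDiv_eq_zero_of_notMem_tsupport {f : Sph → E3} {x : Sph} (hx : x ∉ tsupport f) :
    surfDiv f x = 0 := by
  rw [surfDiv_congr (notMem_tsupport_iff_eventuallyEq.1 hx), surfDiv,
    show fieldExt 0 = fun _ => 0 from funext fun _ => smul_zero _, divergence_const]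

/-! ### Coordinates and the cross product -/

lemma inner_eq_coord (a b : E3) : ⟪a, b⟫ = a 0 * b 0 + a 1 * b 1 + a 2 * b 2 := by
  simp [PiLp.inner_apply, Fin.sum_univ_three, mul_comm]

lemma inner_cross_eq_coord (a b c : E3) :
    ⟪cross a b, c⟫ = (a 1 * b 2 - a 2 * b 1) * c 0 + (a 2 * b 0 - a 0 * b 2) * c 1 +
      (a 0 * b 1 - a 1 * b 0) * c 2 := by
  simp [inner_eq_coord, cross, crossProduct]

/-- The cross product as a continuous bilinear map. -/
def crossCLM : E3 →L[ℝ] E3 →L[ℝ] E3 :=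
  LinearMap.toContinuousBilinearMap
    (LinearMap.mk₂ ℝ cross (fun _ _ _ => by simp [cross]) (fun _ _ _ => by simp [cross])
      (fun _ _ _ => by simp [cross]) fun _ _ _ => by simp [cross])

lemma crossCLM_apply (a b : E3) : crossCLM a b = cross a b := rfl

lemma continuous_cross_comp {α : Type*} [TopologicalSpace α] {f g : α → E3} (hf : Continuous f)
    (hg : Continuous g) : Continuous fun a => cross (f a) (g a) :=
  (crossCLM.continuous.comp hf).clm_apply hg

/-- The coordinates of space, grouped as in the parametrisation of a cone. -/
def splitCoord : E3 ≃L[ℝ] (ℝ × ℝ) × ℝ :=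
  LinearEquiv.toContinuousLinearEquiv
    { toFun := fun y => ((y 0, y 1), y 2)
      invFun := fun p => WithLp.toLp 2 ![p.1.1, p.1.2, p.2]
      map_add' := fun _ _ => rfl
      map_smul' := fun _ _ => rfl
      left_inv := fun y => by
        ext i
        fin_cases i <;> rfl
      right_inv := fun _ => rfl }

lemma splitCoord_apply (y : E3) : splitCoord y = ((y 0, y 1), y 2) := rfl

lemma measurePreserving_splitCoord : MeasurePreserving splitCoord volume volume := by
  have hpi := volume_preserving_piFinSuccAbove (fun _ : Fin 3 => ℝ) 2
  have htwo : MeasurePreserving (Prod.map (id : ℝ → ℝ) (MeasurableEquiv.finTwoArrow (α := ℝ)))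
      (volume.prod volume) (volume.prod volume) :=
    (MeasurePreserving.id volume).prod (volume_preserving_finTwoArrow ℝ)
  have hswap : MeasurePreserving (Prod.swap : ℝ × (ℝ × ℝ) → (ℝ × ℝ) × ℝ) volume volume :=
    Measure.measurePreserving_swap
  exact hswap.comp (htwo.comp (hpi.comp (PiLp.volume_preserving_ofLp (Fin 3))))

/-! ### The area of the radial image of a parametrised surface -/

section RadialImage

variable {X : ℝ × ℝ → E3} {R : Set (ℝ × ℝ)}

/-- The triple product of the two tangent vectors and the position vector of a parametrised
surface. It is the Jacobian of the cone over the surface at height one. -/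
def surfJacobian (X : ℝ × ℝ → E3) (q : ℝ × ℝ) : ℝ :=
  ⟪cross (fderiv ℝ X q (1, 0)) (fderiv ℝ X q (0, 1)), X q⟫

/-- The parametrisation `(q, r) ↦ r • X q` of the cone over a parametrised surface. -/
def coneMap (X : ℝ × ℝ → E3) (y : E3) : E3 := (splitCoord y).2 • X (splitCoord y).1

lemma ne_zero_of_surfJacobian_ne_zero {q : ℝ × ℝ} (h : surfJacobian X q ≠ 0) : X q ≠ 0 := by
  intro h0
  simp [surfJacobian, h0] at h

lemma radial_coneMap {y : E3} (hr : 0 < (splitCoord y).2) (hX : X (splitCoord y).1 ≠ 0) :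
    radial (coneMap X y) = radial (X (splitCoord y).1) :=
  radial_smul hr hX

lemma continuous_surfJacobian (hX : ContDiff ℝ 1 X) : Continuous (surfJacobian X) := by
  have hd := hX.continuous_fderiv one_ne_zero
  exact (continuous_cross_comp (hd.clm_apply continuous_const)
    (hd.clm_apply continuous_const)).inner hX.continuous

/-- The derivative of `coneMap X`. -/
def coneDeriv (X : ℝ × ℝ → E3) (y : E3) : E3 →L[ℝ] E3 :=
  (splitCoord y).2 • (fderiv ℝ X (splitCoord y).1 ∘L .fst ℝ (ℝ × ℝ) ℝ ∘L splitCoord) +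
    (ContinuousLinearMap.snd ℝ (ℝ × ℝ) ℝ ∘L splitCoord).smulRight (X (splitCoord y).1)

lemma contDiff_coneMap (hX : ContDiff ℝ 1 X) : ContDiff ℝ 1 (coneMap X) :=
  splitCoord.contDiff.snd.smul (hX.comp splitCoord.contDiff.fst)

lemma hasFDerivAt_coneMap (hX : Differentiable ℝ X) (y : E3) :
    HasFDerivAt (coneMap X) (coneDeriv X y) y := by
  have hq : HasFDerivAt (fun z => X (splitCoord z).1)
      (fderiv ℝ X (splitCoord y).1 ∘L .fst ℝ (ℝ × ℝ) ℝ ∘L splitCoord) y :=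
    (hX (splitCoord y).1).hasFDerivAt.comp y splitCoord.hasFDerivAt.fst
  exact splitCoord.hasFDerivAt.snd.smul hq

lemma det_coneDeriv (X : ℝ × ℝ → E3) (y : E3) :
    (coneDeriv X y).det = (splitCoord y).2 ^ 2 * surfJacobian X (splitCoord y).1 := by
  rw [ContinuousLinearMap.det,
    ← LinearMap.det_toMatrix (EuclideanSpace.basisFun (Fin 3) ℝ).toBasis, Matrix.det_fin_three]
  simp [LinearMap.toMatrix_apply, coneDeriv, surfJacobian, inner_cross_eq_coord, splitCoord_apply,
    Prod.mk_zero_zero]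
  ring

lemma injOn_coneMap (hX : ∀ q ∈ R, X q ≠ 0) (hinj : InjOn (fun q => radial (X q)) R) :
    InjOn (coneMap X) (splitCoord ⁻¹' (R ×ˢ Ioi 0)) := by
  rintro y ⟨hy, hy0⟩ z ⟨hz, hz0⟩ h
  have hq : (splitCoord y).1 = (splitCoord z).1 := by
    refine hinj hy hz ?_
    simpa only [radial_coneMap hy0 (hX _ hy), radial_coneMap hz0 (hX _ hz)] using
      congrArg radial h
  have hr : (splitCoord y).2 = (splitCoord z).2 := by
    refine smul_left_injective ℝ (hX _ hz) ?_
    simpa only [coneMap, hq] using h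
  exact splitCoord.injective (Prod.ext hq hr)

open scoped Pointwise in
lemma Ioo_smul_radial_image (hX : ∀ q ∈ R, X q ≠ 0) :
    Ioo (0 : ℝ) 1 • ((↑) '' ((fun q => radial (X q)) '' R) : Set E3) =
      coneMap X '' (splitCoord ⁻¹' regionBetween 0 (fun q => ‖X q‖⁻¹) R) := by
  ext y
  constructor
  · rintro ⟨t, ht, _, ⟨_, ⟨q, hq, rfl⟩, rfl⟩, rfl⟩
    have hpos : 0 < ‖X q‖⁻¹ := inv_pos.2 (norm_pos_iff.2 (hX q hq))
    refine ⟨splitCoord.symm (q, t * ‖X q‖⁻¹), ?_, ?_⟩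
    · simpa [regionBetween, hq, ht.1, hpos] using mul_lt_of_lt_one_left hpos ht.2
    · simp [coneMap, coe_radial (hX q hq), smul_smul]
  · rintro ⟨y, ⟨hy, hy0, hy1⟩, rfl⟩
    have hpos : 0 < ‖X (splitCoord y).1‖ := norm_pos_iff.2 (hX _ hy)
    refine ⟨(splitCoord y).2 * ‖X (splitCoord y).1‖, ⟨mul_pos hy0 hpos, ?_⟩, _,
      mem_image_of_mem _ (mem_image_of_mem _ hy), ?_⟩
    · simpa [hpos.ne'] using mul_lt_mul_of_pos_right hy1 hpos
    · simp only [mul_smul, norm_smul_radial (hX _ hy), coneMap]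

lemma lintegral_sq_Ioo {a : ℝ} (ha : 0 ≤ a) :
    ∫⁻ r in Ioo 0 a, ENNReal.ofReal (r ^ 2) = ENNReal.ofReal (a ^ 3 / 3) := by
  rw [← ofReal_integral_eq_lintegral_ofReal, ← integral_Ioc_eq_integral_Ioo,
    ← intervalIntegral.integral_of_le ha, integral_pow]
  · norm_num
  · exact (continuous_pow 2).integrableOn_Icc.mono_set Ioo_subset_Icc_self
  · exact Eventually.of_forall fun r => sq_nonneg r

lemma setLIntegral_regionBetween {α : Type*} [MeasurableSpace α] {μ : Measure α}
    {a b : α → ℝ} (ha : Measurable a) (hb : Measurable b) {s : Set α} (hs : MeasurableSet s)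
    {g : α × ℝ → ENNReal} (hg : Measurable g) :
    ∫⁻ p in regionBetween a b s, g p ∂μ.prod volume =
      ∫⁻ x in s, (∫⁻ r in Ioo (a x) (b x), g (x, r)) ∂μ := by
  have hm := measurableSet_regionBetween ha hb hs
  rw [← lintegral_indicator hm, lintegral_prod _ (hg.indicator hm).aemeasurable,
    ← lintegral_indicator hs]
  congr 1 with x
  have hmem : ∀ r, (x, r) ∈ regionBetween a b s ↔ x ∈ s ∧ r ∈ Ioo (a x) (b x) := fun _ => Iff.rfl
  by_cases hx : x ∈ s
  · rw [indicator_of_mem hx, ← lintegral_indicator measurableSet_Ioo]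
    simp only [indicator, hmem, hx, true_and]
  · simp only [indicator, hmem, hx, false_and, if_false, lintegral_zero]

lemma volume_coneMap_image (hX : ContDiff ℝ 1 X) (hR : MeasurableSet R)
    (hX0 : ∀ q ∈ R, X q ≠ 0) (hinj : InjOn (fun q => radial (X q)) R) :
    volume (coneMap X '' (splitCoord ⁻¹' regionBetween 0 (fun q => ‖X q‖⁻¹) R)) =
      ∫⁻ q in R, ENNReal.ofReal (|surfJacobian X q| * (‖X q‖⁻¹ ^ 3 / 3)) := by
  have hnorm : Measurable fun q => ‖X q‖⁻¹ := hX.continuous.measurable.norm.inv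
  have hK := measurableSet_regionBetween measurable_zero hnorm hR
  have hJ := (continuous_surfJacobian hX).measurable
  have hsub : regionBetween 0 (fun q => ‖X q‖⁻¹) R ⊆ R ×ˢ Ioi 0 := fun p hp => ⟨hp.1, hp.2.1⟩
  let g : (ℝ × ℝ) × ℝ → ENNReal := fun p =>
    ENNReal.ofReal |surfJacobian X p.1| * ENNReal.ofReal (p.2 ^ 2)
  have hgm : Measurable g := by fun_prop
  have hdet : ∀ y, ENNReal.ofReal |(coneDeriv X y).det| = g (splitCoord y) := fun y => by
    rw [det_coneDeriv, abs_mul, abs_of_nonneg (sq_nonneg _), mul_comm,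
      ENNReal.ofReal_mul (abs_nonneg _)]
  rw [← lintegral_abs_det_fderiv_eq_addHaar_image volume (splitCoord.continuous.measurable hK)
    (fun y _ => (hasFDerivAt_coneMap (hX.differentiable one_ne_zero) y).hasFDerivWithinAt)
    ((injOn_coneMap hX0 hinj).mono (preimage_mono hsub))]
  simp_rw [hdet]
  rw [measurePreserving_splitCoord.setLIntegral_comp_preimage hK hgm, Measure.volume_eq_prod,
    setLIntegral_regionBetween measurable_zero hnorm hR hgm]
  refine lintegral_congr fun q => ?_
  rw [ENNReal.ofReal_mul (abs_nonneg _), ← lintegral_sq_Ioo (inv_nonneg.2 (norm_nonneg _)),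
    ← lintegral_const_mul _ (by fun_prop)]
  rfl

lemma continuousAt_radial_comp (hX : Continuous X) {q : ℝ × ℝ} (hq : X q ≠ 0) :
    ContinuousAt (fun q => radial (X q)) q :=
  (continuousAt_radial hq).comp (f := X) hX.continuousAt

open scoped Pointwise in
lemma area_radial_image (hX : ContDiff ℝ 1 X) (hR : MeasurableSet R)
    (hX0 : ∀ q ∈ R, X q ≠ 0) (hinj : InjOn (fun q => radial (X q)) R) :
    area ((fun q => radial (X q)) '' R) =
      ∫⁻ q in R, ENNReal.ofReal (|surfJacobian X q| * ‖X q‖⁻¹ ^ 3) := by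
  have hm : MeasurableSet ((fun q => radial (X q)) '' R) :=
    hR.image_of_continuousOn_injOn
      (fun q hq => (continuousAt_radial_comp hX.continuous (hX0 q hq)).continuousWithinAt) hinj
  have hJ := (continuous_surfJacobian hX).measurable
  have hXm := hX.continuous.measurable
  rw [area, Measure.toSphere_apply' _ hm, Ioo_smul_radial_image hX0,
    volume_coneMap_image hX hR hX0 hinj, ← lintegral_const_mul _ (by fun_prop)]
  refine lintegral_congr fun q => ?_
  rw [show ((Module.finrank ℝ E3 : ℕ) : ENNReal) = ENNReal.ofReal 3 by simp,
    ← ENNReal.ofReal_mul (by norm_num)]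
  congr 1
  ring

lemma area_restrict_radial_image (hX : ContDiff ℝ 1 X) (hR : MeasurableSet R)
    (hX0 : ∀ q ∈ R, X q ≠ 0) (hinj : InjOn (fun q => radial (X q)) R) :
    area.restrict ((fun q => radial (X q)) '' R) = ((volume.restrict R).withDensity fun q =>
      ENNReal.ofReal (|surfJacobian X q| * ‖X q‖⁻¹ ^ 3)).map fun q => radial (X q) := by
  ext T hT
  have hm : Measurable fun q => radial (X q) := measurable_radial.comp hX.continuous.measurable
  rw [Measure.restrict_apply hT, Measure.map_apply hm hT, withDensity_apply _ (hm hT),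
    Measure.restrict_restrict (hm hT), inter_comm _ R, inter_comm T, ← image_inter_preimage]
  exact area_radial_image hX (hR.inter (hm hT)) (fun q hq => hX0 q hq.1)
    (hinj.mono inter_subset_left)

lemma integrableOn_and_setIntegral_radial_image {G : Type*} [NormedAddCommGroup G]
    [NormedSpace ℝ G] {g : Sph → G} (hX : ContDiff ℝ 1 X) (hR : MeasurableSet R)
    (hX0 : ∀ q ∈ R, X q ≠ 0) (hinj : InjOn (fun q => radial (X q)) R)
    (hg : IntegrableOn g ((fun q => radial (X q)) '' R) area) :
    IntegrableOn (fun q => (|surfJacobian X q| * ‖X q‖⁻¹ ^ 3) • g (radial (X q))) R ∧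
      ∫ x in (fun q => radial (X q)) '' R, g x ∂area =
        ∫ q in R, (|surfJacobian X q| * ‖X q‖⁻¹ ^ 3) • g (radial (X q)) := by
  have hm : Measurable fun q => radial (X q) := measurable_radial.comp hX.continuous.measurable
  have hJ := (continuous_surfJacobian hX).measurable
  have hXm := hX.continuous.measurable
  have hρ : Measurable fun q => ENNReal.ofReal (|surfJacobian X q| * ‖X q‖⁻¹ ^ 3) := by fun_prop
  have htop : ∀ᵐ q ∂volume.restrict R,
      ENNReal.ofReal (|surfJacobian X q| * ‖X q‖⁻¹ ^ 3) < ⊤ :=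
    Eventually.of_forall fun _ => ENNReal.ofReal_lt_top
  have hto : ∀ q, (ENNReal.ofReal (|surfJacobian X q| * ‖X q‖⁻¹ ^ 3)).toReal =
      |surfJacobian X q| * ‖X q‖⁻¹ ^ 3 := fun q => ENNReal.toReal_ofReal (by positivity)
  rw [IntegrableOn, area_restrict_radial_image hX hR hX0 hinj] at hg
  constructor
  · simpa only [hto] using! (integrable_withDensity_iff_integrable_smul' hρ htop).1
      ((integrable_map_measure hg.aestronglyMeasurable hm.aemeasurable).1 hg)
  · rw [area_restrict_radial_image hX hR hX0 hinj,
      integral_map hm.aemeasurable hg.aestronglyMeasurable,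
      integral_withDensity_eq_integral_toReal_smul hρ htop]
    simp only [hto]

lemma exists_hasStrictFDerivAt_coneMap (hX : ContDiff ℝ 1 X) {y : E3} (hr : (splitCoord y).2 ≠ 0)
    (hJ : surfJacobian X (splitCoord y).1 ≠ 0) :
    ∃ e : E3 ≃L[ℝ] E3, HasStrictFDerivAt (coneMap X) (e : E3 →L[ℝ] E3) y := by
  have hdet : (coneDeriv X y).det ≠ 0 := by
    rw [det_coneDeriv]
    exact mul_ne_zero (pow_ne_zero 2 hr) hJ
  refine ⟨(coneDeriv X y).toContinuousLinearEquivOfDetNeZero hdet, ?_⟩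
  rw [ContinuousLinearMap.coe_toContinuousLinearEquivOfDetNeZero]
  exact (contDiff_coneMap hX).contDiffAt.hasStrictFDerivAt'
    (hasFDerivAt_coneMap (hX.differentiable one_ne_zero) y) one_ne_zero

variable {q : ℝ × ℝ}

lemma exists_nhds_injOn_radial_comp (hX : ContDiff ℝ 1 X) (hJ : surfJacobian X q ≠ 0) :
    ∃ N ∈ 𝓝 q, InjOn (fun q => radial (X q)) N := by
  have hq := ne_zero_of_surfJacobian_ne_zero hJ
  -- The section of the cone over the surface that lies on the sphere.
  set j : ℝ × ℝ → E3 := fun p => splitCoord.symm (p, ‖X p‖⁻¹) with hj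
  have hj_cont : ContinuousAt j q := splitCoord.symm.continuous.continuousAt.comp
    (continuousAt_id.prodMk (hX.continuous.continuousAt.norm.inv₀ (norm_ne_zero_iff.2 hq)))
  have hj_inj : Function.Injective j := fun p p' h =>
    congrArg Prod.fst (splitCoord.symm.injective h)
  have hcoe : ∀ p, X p ≠ 0 → coneMap X (j p) = radial (X p) := fun p hp => by
    simp [coneMap, hj, coe_radial hp]
  obtain ⟨e, he⟩ := exists_hasStrictFDerivAt_coneMap (y := j q) hX (by simpa [hj] using hq)
    (by simpa [hj] using hJ)
  have hsource := (he.toOpenPartialHomeomorph _).open_source.mem_nhds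
    he.mem_toOpenPartialHomeomorph_source
  refine ⟨_, inter_mem (hj_cont.preimage_mem_nhds hsource)
    (hX.continuous.continuousAt.eventually_ne hq), ?_⟩
  rintro p ⟨hp, hp0⟩ p' ⟨hp', hp0'⟩ h
  refine hj_inj ((he.toOpenPartialHomeomorph _).injOn hp hp' ?_)
  simpa only [he.toOpenPartialHomeomorph_coe, hcoe p hp0, hcoe p' hp0'] using congrArg _ h

lemma map_radial_comp_nhds (hX : ContDiff ℝ 1 X) (hJ : surfJacobian X q ≠ 0) :
    map (fun q => radial (X q)) (𝓝 q) = 𝓝 (radial (X q)) := by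
  have hq := ne_zero_of_surfJacobian_ne_zero hJ
  set y : E3 := splitCoord.symm (q, 1) with hy
  have hcone : coneMap X y = X q := by simp [coneMap, hy]
  obtain ⟨e, he⟩ := exists_hasStrictFDerivAt_coneMap (y := y) hX (by simp [hy])
    (by simpa [hy] using hJ)
  have hfst : map (fun z => (splitCoord z).1) (𝓝 y) = 𝓝 q := by
    have h := map_fst_nhds (q, (1 : ℝ))
    rwa [← splitCoord.apply_symm_apply (q, (1 : ℝ)), ← splitCoord.map_nhds_eq, map_map,
      splitCoord.apply_symm_apply] at h
  have hev : (fun z => radial (X (splitCoord z).1)) =ᶠ[𝓝 y] radial ∘ coneMap X := by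
    have hpos : 0 < (splitCoord y).2 := by simp [hy]
    have hXy : X (splitCoord y).1 ≠ 0 := by simpa [hy] using hq
    filter_upwards [splitCoord.continuous.snd.continuousAt.eventually (lt_mem_nhds hpos),
      (hX.continuous.comp splitCoord.continuous.fst).continuousAt.eventually_ne hXy]
      with z hz hXz using (radial_coneMap hz hXz).symm
  calc map (fun q => radial (X q)) (𝓝 q)
      = map (fun z => radial (X (splitCoord z).1)) (𝓝 y) := by rw [← hfst, map_map]; rfl
    _ = map radial (map (coneMap X) (𝓝 y)) := by rw [map_congr hev, map_map]
    _ = 𝓝 (radial (X q)) := by rw [he.map_nhds_eq_of_equiv, hcone, map_radial_nhds hq]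

lemma isOpen_radial_image (hX : ContDiff ℝ 1 X) {O : Set (ℝ × ℝ)} (hO : IsOpen O)
    (hJ : ∀ q ∈ O, surfJacobian X q ≠ 0) : IsOpen ((fun q => radial (X q)) '' O) := by
  rw [isOpen_iff_mem_nhds]
  rintro _ ⟨q, hq, rfl⟩
  rw [← map_radial_comp_nhds hX (hJ q hq)]
  exact image_mem_map (hO.mem_nhds hq)

end RadialImage

/-! ### Green's formula on a rectangle -/

section Rectangle

variable {G : Type*} [NormedAddCommGroup G] [NormedSpace ℝ G] {a b t₀ t₁ : ℝ}
  {A B A' B' : ℝ × ℝ → G}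

lemma setIntegral_partial_snd [CompleteSpace G] (ht : t₀ ≤ t₁)
    (hB' : ContinuousOn B' (Icc a b ×ˢ Icc t₀ t₁))
    (dB : ∀ s ∈ Icc a b, ∀ t ∈ Icc t₀ t₁, HasDerivAt (fun t => B (s, t)) (B' (s, t)) t) :
    ∫ q in Icc a b ×ˢ Icc t₀ t₁, B' q = ∫ s in Icc a b, (B (s, t₁) - B (s, t₀)) := by
  have hint := hB'.integrableOn_compact (μ := volume) (isCompact_Icc.prod isCompact_Icc)
  rw [Measure.volume_eq_prod] at hint ⊢
  rw [setIntegral_prod _ hint]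
  refine setIntegral_congr_fun measurableSet_Icc fun s hs => ?_
  have hslice : ContinuousOn (fun t => B' (s, t)) (Icc t₀ t₁) :=
    hB'.comp (by fun_prop) fun t ht => ⟨hs, ht⟩
  rw [integral_Icc_eq_integral_Ioc, ← intervalIntegral.integral_of_le ht]
  refine intervalIntegral.integral_eq_sub_of_hasDerivAt (f := fun t => B (s, t))
    (fun t ht' => dB s hs t ?_) (hslice.intervalIntegrable_of_Icc ht)
  rwa [uIcc_of_le ht] at ht'

lemma setIntegral_partial_fst [CompleteSpace G] (hab : a ≤ b)
    (hA' : ContinuousOn A' (Icc a b ×ˢ Icc t₀ t₁))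
    (dA : ∀ s ∈ Icc a b, ∀ t ∈ Icc t₀ t₁, HasDerivAt (fun s => A (s, t)) (A' (s, t)) s) :
    ∫ q in Icc a b ×ˢ Icc t₀ t₁, A' q = ∫ t in Icc t₀ t₁, (A (b, t) - A (a, t)) := by
  rw [Measure.volume_eq_prod, ← setIntegral_prod_swap, ← Measure.volume_eq_prod]
  exact setIntegral_partial_snd (B := A ∘ Prod.swap) (B' := A' ∘ Prod.swap) hab
    (hA'.comp continuous_swap.continuousOn fun _ hp => ⟨hp.2, hp.1⟩) fun t ht s hs => dA s hs t ht

lemma continuousOn_setIntegral_fst {K T : Set ℝ} (hK : IsCompact K) (hT : IsCompact T)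
    (hB : ContinuousOn B (K ×ˢ T)) : ContinuousOn (fun t => ∫ s in K, B (s, t)) T := by
  obtain ⟨C, hC⟩ := (hK.prod hT).exists_bound_of_continuousOn hB
  have hKm := hK.measurableSet
  refine continuousOn_of_dominated (bound := fun _ => C) (fun t ht => ?_) (fun t ht => ?_)
    (integrableOn_const hK.measure_lt_top.ne) ?_
  · exact (hB.comp (f := fun s => (s, t)) (by fun_prop)
      fun s hs => ⟨hs, ht⟩).aestronglyMeasurable hKm
  · filter_upwards [ae_restrict_mem hKm] with s hs using hC _ ⟨hs, ht⟩
  · filter_upwards [ae_restrict_mem hKm] with s hs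
    exact hB.comp (f := fun t => (s, t)) (by fun_prop) fun t ht => ⟨hs, ht⟩

lemma tendsto_setIntegral_prod_Icc {f : ℝ × ℝ → G} {K : Set ℝ} (hK : MeasurableSet K)
    {e : ℕ → ℝ} (hanti : Antitone e) (he : ∀ k, t₀ < e k) (hlim : Tendsto e atTop (𝓝 t₀))
    (hf : IntegrableOn f (K ×ˢ Ioc t₀ t₁)) :
    Tendsto (fun k => ∫ q in K ×ˢ Icc (e k) t₁, f q) atTop
      (𝓝 (∫ q in K ×ˢ Ioc t₀ t₁, f q)) := by
  have hunion : ⋃ k, K ×ˢ Icc (e k) t₁ = K ×ˢ Ioc t₀ t₁ := by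
    rw [← prod_iUnion]
    congr 1
    ext t
    simp only [mem_iUnion, mem_Icc, mem_Ioc, exists_and_right, and_congr_left_iff]
    refine fun _ => ⟨fun ⟨k, hk⟩ => (he k).trans_le hk, fun ht => ?_⟩
    exact ((hlim.eventually (gt_mem_nhds ht)).exists).imp fun _ hk => hk.le
  rw [← hunion] at hf ⊢
  exact tendsto_setIntegral_of_monotone (fun _ => hK.prod measurableSet_Icc)
    (fun _ _ hij => prod_mono_right (Icc_subset_Icc_left (hanti hij))) hf

/-- Only continuity is required on the lower side: it will lie on the boundary curve. -/
lemma setIntegral_curl_rectangle [CompleteSpace G] (hab : a ≤ b) (ht : t₀ < t₁)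
    (hB : ContinuousOn B (Icc a b ×ˢ Icc t₀ t₁))
    (hA' : ContinuousOn A' (Icc a b ×ˢ Ioc t₀ t₁)) (hB' : ContinuousOn B' (Icc a b ×ˢ Ioc t₀ t₁))
    (dA : ∀ s ∈ Icc a b, ∀ t ∈ Ioc t₀ t₁, HasDerivAt (fun s => A (s, t)) (A' (s, t)) s)
    (dB : ∀ s ∈ Icc a b, ∀ t ∈ Ioc t₀ t₁, HasDerivAt (fun t => B (s, t)) (B' (s, t)) t)
    (hAa : ∀ t ∈ Ioc t₀ t₁, A (a, t) = 0) (hAb : ∀ t ∈ Ioc t₀ t₁, A (b, t) = 0)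
    (hBt : ∀ s ∈ Icc a b, B (s, t₁) = 0)
    (hint : IntegrableOn (fun q => A' q - B' q) (Icc a b ×ˢ Ioc t₀ t₁)) :
    ∫ q in Icc a b ×ˢ Ioc t₀ t₁, (A' q - B' q) = ∫ s in a..b, B (s, t₀) := by
  have hinner : ∀ e ∈ Ioo t₀ t₁,
      ∫ q in Icc a b ×ˢ Icc e t₁, (A' q - B' q) = ∫ s in Icc a b, B (s, e) := by
    intro e he
    have hsub : Icc e t₁ ⊆ Ioc t₀ t₁ := fun t h => ⟨he.1.trans_le h.1, h.2⟩
    have hA'e := hA'.mono (prod_mono_right (s := Icc a b) hsub)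
    have hB'e := hB'.mono (prod_mono_right (s := Icc a b) hsub)
    have hK : IsCompact (Icc a b ×ˢ Icc e t₁) := isCompact_Icc.prod isCompact_Icc
    have hsides : ∫ t in Icc e t₁, (A (b, t) - A (a, t)) = 0 :=
      setIntegral_eq_zero_of_forall_eq_zero fun t h => by simp [hAa t (hsub h), hAb t (hsub h)]
    have hbottom : ∫ s in Icc a b, (B (s, t₁) - B (s, e)) = ∫ s in Icc a b, -B (s, e) :=
      setIntegral_congr_fun measurableSet_Icc fun s h => by simp [hBt s h]
    rw [integral_sub (hA'e.integrableOn_compact hK) (hB'e.integrableOn_compact hK),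
      setIntegral_partial_fst hab hA'e fun s hs t h => dA s hs t (hsub h),
      setIntegral_partial_snd he.2.le hB'e fun s hs t h => dB s hs t (hsub h),
      hsides, hbottom, integral_neg, zero_sub, neg_neg]
  obtain ⟨e, hanti, he, hlim⟩ := exists_seq_strictAnti_tendsto' ht
  have hleft := tendsto_setIntegral_prod_Icc measurableSet_Icc hanti.antitone
    (fun k => (he k).1) hlim hint
  have hright : Tendsto (fun k => ∫ s in Icc a b, B (s, e k)) atTop
      (𝓝 (∫ s in Icc a b, B (s, t₀))) :=
    (continuousOn_setIntegral_fst isCompact_Icc isCompact_Icc hB t₀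
      (left_mem_Icc.2 ht.le)).tendsto.comp (tendsto_nhdsWithin_iff.2
        ⟨hlim, Eventually.of_forall fun k => Ioo_subset_Icc_self (he k)⟩)
  rw [intervalIntegral.integral_of_le hab, ← integral_Icc_eq_integral_Ioc]
  exact tendsto_nhds_unique hleft (hright.congr fun k => (hinner _ (he k)).symm)

end Rectangle

/-! ### The divergence theorem on a patch -/

lemma trace_mul_inner_cross (M : E3 →L[ℝ] E3) (a b c : E3) :
    ⟪cross (M a) b, c⟫ + ⟪cross a (M b), c⟫ + ⟪cross a b, M c⟫ =
      LinearMap.trace ℝ E3 M * ⟪cross a b, c⟫ := by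
  have happly : ∀ (v : E3) (i : Fin 3),
      M v i = ∑ j : Fin 3, v j * M (EuclideanSpace.single j 1) i := by
    intro v i
    conv_lhs => rw [← (EuclideanSpace.basisFun (Fin 3) ℝ).sum_repr v]
    simp
  have htrace : LinearMap.trace ℝ E3 M = ∑ i : Fin 3, M (EuclideanSpace.single i 1) i := by
    rw [LinearMap.trace_eq_matrix_trace ℝ (EuclideanSpace.basisFun (Fin 3) ℝ).toBasis]
    simp [Matrix.trace, LinearMap.toMatrix_apply]
  simp only [htrace, inner_cross_eq_coord, happly a, happly b, happly c, Fin.sum_univ_three]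
  ring

lemma hasFDerivAt_cross_id {F : E3 → E3} {F' : E3 →L[ℝ] E3} {y : E3} (hF : HasFDerivAt F F' y) :
    HasFDerivAt (fun z => cross z (F z)) (crossCLM y ∘L F' + crossCLM.flip (F y)) y :=
  crossCLM.hasFDerivAt.clm_apply hF

/-- The exterior derivative of the flux form `v ↦ ⟪y × F y, v⟫` of a field that is homogeneous of
degree `-2`; no other degree gives a multiple of the divergence. -/
lemma inner_fderiv_cross_sub {F : E3 → E3} {y : E3} (hF : DifferentiableAt ℝ F y)
    (hF2 : fderiv ℝ F y y = (-2 : ℝ) • F y) (v w : E3) :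
    ⟪fderiv ℝ (fun z => cross z (F z)) y w, v⟫ - ⟪fderiv ℝ (fun z => cross z (F z)) y v, w⟫ =
      ⟪cross w v, y⟫ * divergence F y := by
  have htrace := trace_mul_inner_cross (fderiv ℝ F y) w v y
  rw [hF2] at htrace
  simp only [(hasFDerivAt_cross_id hF.hasFDerivAt).fderiv, _root_.add_apply,
    ContinuousLinearMap.comp_apply, ContinuousLinearMap.flip_apply, crossCLM_apply,
    inner_add_left, divergence]
  simp only [inner_cross_eq_coord, PiLp.smul_apply, smul_eq_mul] at htrace ⊢
  linear_combination htrace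

/-- The field `y × f`, whose circulation along a curve is the flux of `f` across it. -/
def fluxField (f : Sph → E3) (y : E3) : E3 := cross y (fieldExt f y)

lemma fluxField_eq_zero {f : Sph → E3} {y : E3} (hf : f (radial y) = 0) : fluxField f y = 0 := by
  rw [fluxField, fieldExt, hf, smul_zero]
  exact map_zero (crossCLM y)

lemma continuousOn_fluxField_comp {f : Sph → E3} {S : Set Sph} {X : ℝ × ℝ → E3} {R : Set (ℝ × ℝ)}
    (hf : ContinuousOn f S) (hX : Continuous X) (hX0 : ∀ q ∈ R, X q ≠ 0)
    (hR : ∀ q ∈ R, radial (X q) ∈ S) : ContinuousOn (fun q => fluxField f (X q)) R := by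
  have hnorm : ContinuousOn (fun q => ‖X q‖ ^ (-2 : ℤ)) R :=
    hX.norm.continuousOn.zpow₀ _ fun q hq => Or.inl (norm_ne_zero_iff.2 (hX0 q hq))
  have hradial : ContinuousOn (fun q => radial (X q)) R := fun q hq =>
    (continuousAt_radial_comp hX (hX0 q hq)).continuousWithinAt
  exact (crossCLM.continuous.comp hX).continuousOn.clm_apply (hnorm.smul (hf.comp hradial hR))

/-- The vector fields on `S` to which the divergence theorem applies. Up to the boundary, only
continuity of the field and integrability of its divergence are required. -/
structure IsDivField (f : Sph → E3) (S : Set Sph) : Prop where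
  continuousOn : ContinuousOn f (closure S)
  contDiffOn : ContDiffOn ℝ 1 (fieldExt f) (cone S)
  integrable : IntegrableOn (surfDiv f) S area

namespace IsDivField

variable {f : Sph → E3} {S : Set Sph}

lemma differentiableAt_fieldExt (hf : IsDivField f S) (hS : IsOpen S) {y : E3} (hy : y ∈ cone S) :
    DifferentiableAt ℝ (fieldExt f) y :=
  (hf.contDiffOn.differentiableOn one_ne_zero).differentiableAt ((isOpen_cone hS).mem_nhds hy)

lemma differentiableAt_fluxField (hf : IsDivField f S) (hS : IsOpen S) {y : E3} (hy : y ∈ cone S) :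
    DifferentiableAt ℝ (fluxField f) y :=
  (hasFDerivAt_cross_id (hf.differentiableAt_fieldExt hS hy).hasFDerivAt).differentiableAt

lemma continuousOn_fderiv_fluxField (hf : IsDivField f S) (hS : IsOpen S) :
    ContinuousOn (fderiv ℝ (fluxField f)) (cone S) :=
  (crossCLM.contDiff.contDiffOn.clm_apply hf.contDiffOn).continuousOn_fderiv_of_isOpen
    (isOpen_cone hS) le_rfl

end IsDivField

/-- The ruled surface over the curve `c` with rulings of direction `n`. -/
def ruled (c : ℝ → E3) (n : E3) (q : ℝ × ℝ) : E3 := c q.1 + q.2 • n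

/-- The radial projection of a ruled surface. -/
def patch (c : ℝ → E3) (n : E3) (q : ℝ × ℝ) : Sph := radial (ruled c n q)

section Ruled

variable {c : ℝ → E3} {n : E3}

lemma contDiff_ruled (hc : ContDiff ℝ 1 c) : ContDiff ℝ 1 (ruled c n) :=
  (hc.comp contDiff_fst).add (contDiff_snd.smul contDiff_const)

lemma hasDerivAt_ruled_fst (hc : Differentiable ℝ c) (s t : ℝ) :
    HasDerivAt (fun s => ruled c n (s, t)) (deriv c s) s :=
  (hc s).hasDerivAt.add_const (t • n)

lemma hasDerivAt_ruled_snd (s t : ℝ) : HasDerivAt (fun t => ruled c n (s, t)) n t := by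
  simpa [ruled] using ((hasDerivAt_id t).smul_const n).const_add (c s)

lemma inner_cross_ruled (v : E3) (q : ℝ × ℝ) :
    ⟪cross v n, ruled c n q⟫ = ⟪cross v n, c q.1⟫ := by
  simp only [ruled, inner_cross_eq_coord, PiLp.add_apply, PiLp.smul_apply, smul_eq_mul]
  ring

lemma surfJacobian_ruled (hc : ContDiff ℝ 1 c) (q : ℝ × ℝ) :
    surfJacobian (ruled c n) q = ⟪cross (deriv c q.1) n, c q.1⟫ := by
  have hd := ((contDiff_ruled (n := n) hc).differentiable one_ne_zero q).hasFDerivAt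
  have hfst : fderiv ℝ (ruled c n) q (1, 0) = deriv c q.1 :=
    (hd.comp_hasDerivAt (f := fun s => (s, q.2)) q.1 ((hasDerivAt_id q.1).prodMk
      (hasDerivAt_const q.1 q.2))).unique
      (hasDerivAt_ruled_fst (hc.differentiable one_ne_zero) q.1 q.2)
  have hsnd : fderiv ℝ (ruled c n) q (0, 1) = n :=
    (hd.comp_hasDerivAt (f := fun t => (q.1, t)) q.2 ((hasDerivAt_const q.2 q.1).prodMk
      (hasDerivAt_id q.2))).unique (hasDerivAt_ruled_snd q.1 q.2)
  rw [surfJacobian, hfst, hsnd, inner_cross_ruled]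

lemma continuousAt_patch (hc : ContDiff ℝ 1 c) {q : ℝ × ℝ} (hq : surfJacobian (ruled c n) q ≠ 0) :
    ContinuousAt (patch c n) q :=
  continuousAt_radial_comp (contDiff_ruled hc).continuous (ne_zero_of_surfJacobian_ne_zero hq)

lemma surfJacobian_smul_surfDiv_patch (hc : ContDiff ℝ 1 c) {f : Sph → E3} {q : ℝ × ℝ}
    (hJ : 0 < surfJacobian (ruled c n) q)
    (hf : DifferentiableAt ℝ (fieldExt f) (ruled c n q)) :
    (|surfJacobian (ruled c n) q| * ‖ruled c n q‖⁻¹ ^ 3) • surfDiv f (patch c n q) =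
      ⟪fderiv ℝ (fluxField f) (ruled c n q) (deriv c q.1), n⟫ -
        ⟪fderiv ℝ (fluxField f) (ruled c n q) n, deriv c q.1⟫ := by
  have hne : ruled c n q ≠ 0 := ne_zero_of_surfJacobian_ne_zero hJ.ne'
  have hnorm := norm_ne_zero_iff.2 hne
  unfold fluxField
  rw [inner_fderiv_cross_sub hf (fderiv_fieldExt_self hne hf), inner_cross_ruled,
    ← surfJacobian_ruled hc, patch, surfDiv_radial f hne, abs_of_pos hJ, smul_eq_mul]
  field_simp

/-- The divergence theorem on a patch, for a field that vanishes on all sides but the lower one. -/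
lemma setIntegral_surfDiv_patch (hc : ContDiff ℝ 1 c) {a b t₀ t₁ : ℝ}
    (hab : a ≤ b) (ht : t₀ < t₁)
    (hJ : ∀ q ∈ Icc a b ×ˢ Icc t₀ t₁, 0 < surfJacobian (ruled c n) q)
    (hinj : InjOn (patch c n) (Icc a b ×ˢ Ioc t₀ t₁)) {S : Set Sph} (hSo : IsOpen S)
    (hS : ∀ q ∈ Icc a b ×ˢ Ioc t₀ t₁, patch c n q ∈ S) {f : Sph → E3} (hf : IsDivField f S)
    (ha : ∀ t ∈ Ioc t₀ t₁, f (patch c n (a, t)) = 0)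
    (hb : ∀ t ∈ Ioc t₀ t₁, f (patch c n (b, t)) = 0)
    (htop : ∀ s ∈ Icc a b, f (patch c n (s, t₁)) = 0) :
    ∫ x in patch c n '' (Icc a b ×ˢ Ioc t₀ t₁), surfDiv f x ∂area =
      ∫ s in a..b, ⟪fluxField f (ruled c n (s, t₀)), deriv c s⟫ := by
  have hX : Continuous (ruled c n) := (contDiff_ruled hc).continuous
  have hdc : Continuous fun q : ℝ × ℝ => deriv c q.1 :=
    (hc.continuous_deriv le_rfl).comp continuous_fst
  have hsub : Icc a b ×ˢ Ioc t₀ t₁ ⊆ Icc a b ×ˢ Icc t₀ t₁ := prod_mono_right Ioc_subset_Icc_self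
  have hX0 : ∀ q ∈ Icc a b ×ˢ Icc t₀ t₁, ruled c n q ≠ 0 := fun q hq =>
    ne_zero_of_surfJacobian_ne_zero (hJ q hq).ne'
  have hcone : ∀ q ∈ Icc a b ×ˢ Ioc t₀ t₁, ruled c n q ∈ cone S := fun q hq =>
    ⟨hX0 q (hsub hq), hS q hq⟩
  have hclosure : ∀ q ∈ Icc a b ×ˢ Icc t₀ t₁, patch c n q ∈ closure S := fun q hq =>
    (continuousAt_patch hc (hJ q hq).ne').continuousWithinAt.mem_closure
      (by rwa [closure_prod_eq, closure_Icc, closure_Ioc ht.ne]) hS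
  have hflux := continuousOn_fluxField_comp hf.continuousOn hX hX0 hclosure
  have hflux' := (hf.continuousOn_fderiv_fluxField hSo).comp hX.continuousOn hcone
  have hzero : ∀ q, f (patch c n q) = 0 → fluxField f (ruled c n q) = 0 := fun q hq =>
    fluxField_eq_zero hq
  have hcurl := fun q hq => surfJacobian_smul_surfDiv_patch hc (hJ q (hsub hq))
    (hf.differentiableAt_fieldExt hSo (hcone q hq))
  have hdiff := fun q hq => (hf.differentiableAt_fluxField hSo (hcone q hq)).hasFDerivAt
  have hm : MeasurableSet (Icc a b ×ˢ Ioc t₀ t₁) := measurableSet_Icc.prod measurableSet_Ioc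
  obtain ⟨hint, heq⟩ := integrableOn_and_setIntegral_radial_image (contDiff_ruled hc) hm
    (fun q hq => hX0 q (hsub hq)) hinj (hf.integrable.mono_set (image_subset_iff.2 hS))
  refine heq.trans ((setIntegral_congr_fun hm hcurl).trans ?_)
  refine setIntegral_curl_rectangle (A := fun q => ⟪fluxField f (ruled c n q), n⟫)
    (B := fun q => ⟪fluxField f (ruled c n q), deriv c q.1⟫) hab ht (hflux.inner hdc.continuousOn)
    ((hflux'.clm_apply hdc.continuousOn).inner continuousOn_const)
    ((hflux'.clm_apply continuousOn_const).inner hdc.continuousOn) (fun s hs t ht' => ?_)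
    (fun s hs t ht' => ?_) (fun t h => by simp [hzero _ (ha t h)])
    (fun t h => by simp [hzero _ (hb t h)]) (fun s h => by simp [hzero _ (htop s h)])
    ((integrableOn_congr_fun hcurl hm).1 hint)
  · simpa using ((hdiff (s, t) ⟨hs, ht'⟩).comp_hasDerivAt s
      (hasDerivAt_ruled_fst (hc.differentiable one_ne_zero) s t)).inner ℝ (hasDerivAt_const s n)
  · simpa using ((hdiff (s, t) ⟨hs, ht'⟩).comp_hasDerivAt t
      (hasDerivAt_ruled_snd s t)).inner ℝ (hasDerivAt_const t (deriv c s))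

end Ruled

/-! ### The divergence theorem for fields of small support -/

/-- The open square of radius `δ` around `(s₀, 0)`. -/
def openBox (s₀ δ : ℝ) : Set (ℝ × ℝ) := Ioo (s₀ - δ) (s₀ + δ) ×ˢ Ioo (-δ) δ

/-- The closed square of radius `δ` around `(s₀, 0)`. -/
def closedBox (s₀ δ : ℝ) : Set (ℝ × ℝ) := Icc (s₀ - δ) (s₀ + δ) ×ˢ Icc (-δ) δ

lemma openBox_subset_closedBox {s₀ δ : ℝ} : openBox s₀ δ ⊆ closedBox s₀ δ :=
  prod_mono Ioo_subset_Icc_self Ioo_subset_Icc_self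

lemma closedBox_mono {s₀ δ δ' : ℝ} (h : δ ≤ δ') : closedBox s₀ δ ⊆ closedBox s₀ δ' :=
  prod_mono (Icc_subset_Icc (by linarith) (by linarith)) (Icc_subset_Icc (by linarith) h)

lemma exists_closedBox_subset {s₀ r : ℝ} (hr : 0 < r) {N : Set (ℝ × ℝ)} (hN : N ∈ 𝓝 (s₀, 0)) :
    ∃ δ > 0, δ ≤ r ∧ closedBox s₀ δ ⊆ N := by
  obtain ⟨δ, hδ, h⟩ := Metric.nhds_basis_closedBall.mem_iff.1 hN
  rw [← closedBall_prod_same, Real.closedBall_eq_Icc, Real.closedBall_eq_Icc, zero_sub,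
    zero_add] at h
  exact ⟨min δ r, lt_min hδ hr, min_le_right _ _, (closedBox_mono (min_le_left _ _)).trans h⟩

/-- The patch `patch c n` is a chart of the sphere near the closed square of radius `δ` around
`(s₀, 0)`. -/
structure IsChartOn (c : ℝ → E3) (n : E3) (s₀ δ : ℝ) : Prop where
  contDiff : ContDiff ℝ 1 c
  pos : 0 < δ
  injOn : InjOn (patch c n) (closedBox s₀ δ)
  surfJacobian_pos : ∀ q ∈ closedBox s₀ δ, 0 < surfJacobian (ruled c n) q

lemma exists_isChartOn {c : ℝ → E3} {n : E3} {s₀ r : ℝ} (hc : ContDiff ℝ 1 c) (hr : 0 < r)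
    (hJ : 0 < surfJacobian (ruled c n) (s₀, 0)) {N : Set (ℝ × ℝ)} (hN : N ∈ 𝓝 (s₀, 0)) :
    ∃ δ ≤ r, IsChartOn c n s₀ δ ∧ closedBox s₀ δ ⊆ N := by
  have hX := contDiff_ruled (n := n) hc
  obtain ⟨N', hN', hinj⟩ := exists_nhds_injOn_radial_comp hX hJ.ne'
  have hpos : {q | 0 < surfJacobian (ruled c n) q} ∈ 𝓝 (s₀, 0) :=
    (isOpen_lt continuous_const (continuous_surfJacobian hX)).mem_nhds hJ
  obtain ⟨δ, hδ, hδr, hbox⟩ := exists_closedBox_subset hr (inter_mem hN (inter_mem hN' hpos))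
  exact ⟨δ, hδr, ⟨hc, hδ, hinj.mono fun q hq => (hbox hq).2.1, fun q hq => (hbox hq).2.2⟩,
    fun q hq => (hbox hq).1⟩

namespace IsChartOn

variable {c : ℝ → E3} {n : E3} {s₀ δ : ℝ}

lemma continuousOn (h : IsChartOn c n s₀ δ) : ContinuousOn (patch c n) (closedBox s₀ δ) :=
  fun q hq => (continuousAt_patch h.contDiff (h.surfJacobian_pos q hq).ne').continuousWithinAt

lemma isOpen_image (h : IsChartOn c n s₀ δ) : IsOpen (patch c n '' openBox s₀ δ) :=
  isOpen_radial_image (contDiff_ruled h.contDiff) (isOpen_Ioo.prod isOpen_Ioo)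
    fun q hq => (h.surfJacobian_pos q (openBox_subset_closedBox hq)).ne'

lemma center_mem (h : IsChartOn c n s₀ δ) : (s₀, 0) ∈ openBox s₀ δ := by
  simp [openBox, h.pos]

lemma apply_eq_zero (h : IsChartOn c n s₀ δ) {f : Sph → E3}
    (hf : tsupport f ⊆ patch c n '' openBox s₀ δ) {q : ℝ × ℝ} (hq : q ∈ closedBox s₀ δ)
    (hq' : q ∉ openBox s₀ δ) : f (patch c n q) = 0 := by
  refine image_eq_zero_of_notMem_tsupport fun hmem => ?_
  obtain ⟨p, hp, hpq⟩ := hf hmem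
  exact hq' (h.injOn (openBox_subset_closedBox hp) hq hpq ▸ hp)

/-- The divergence theorem for a field supported in a chart in which `S` is the set `t₀ < t`. -/
lemma setIntegral_surfDiv (h : IsChartOn c n s₀ δ) {t₀ : ℝ} (ht₀ : t₀ ∈ Ico (-δ) δ)
    {S : Set Sph} (hSo : IsOpen S)
    (hS : ∀ q ∈ closedBox s₀ δ, t₀ < q.2 → patch c n q ∈ S)
    (hS' : ∀ q ∈ openBox s₀ δ, patch c n q ∈ S → t₀ < q.2)
    {f : Sph → E3} (hf : IsDivField f S) (hsupp : tsupport f ⊆ patch c n '' openBox s₀ δ) :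
    ∫ x in S, surfDiv f x ∂area =
      ∫ s in (s₀ - δ)..(s₀ + δ), ⟪fluxField f (ruled c n (s, t₀)), deriv c s⟫ := by
  have hab : s₀ - δ ≤ s₀ + δ := by linarith [h.pos]
  have hclosed : ∀ q ∈ Icc (s₀ - δ) (s₀ + δ) ×ˢ Icc t₀ δ, q ∈ closedBox s₀ δ :=
    prod_mono_right (Icc_subset_Icc_left ht₀.1)
  have hsub : Icc (s₀ - δ) (s₀ + δ) ×ˢ Ioc t₀ δ ⊆ Icc (s₀ - δ) (s₀ + δ) ×ˢ Icc t₀ δ :=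
    prod_mono_right Ioc_subset_Icc_self
  have hSsub : ∀ q ∈ Icc (s₀ - δ) (s₀ + δ) ×ˢ Ioc t₀ δ, patch c n q ∈ S := fun q hq =>
    hS q (hclosed q (hsub hq)) hq.2.1
  have hside : ∀ s ∈ Icc (s₀ - δ) (s₀ + δ), ∀ t ∈ Ioc t₀ δ, (s, t) ∉ openBox s₀ δ →
      f (patch c n (s, t)) = 0 := fun s hs t ht hq =>
    h.apply_eq_zero hsupp (hclosed _ (hsub ⟨hs, ht⟩)) hq
  rw [← setIntegral_surfDiv_patch h.contDiff hab ht₀.2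
    (fun q hq => h.surfJacobian_pos q (hclosed q hq))
    (h.injOn.mono fun q hq => hclosed q (hsub hq)) hSo hSsub hf
    (fun t ht => hside _ (left_mem_Icc.2 hab) t ht (by simp [openBox]))
    (fun t ht => hside _ (right_mem_Icc.2 hab) t ht (by simp [openBox]))
    (fun s hs => hside s hs δ (right_mem_Ioc.2 ht₀.2) (by simp [openBox]))]
  refine setIntegral_eq_of_subset_of_forall_sdiff_eq_zero hSo.measurableSet
    (image_subset_iff.2 hSsub) fun x hx => surfDiv_eq_zero_of_notMem_tsupport fun hmem => ?_
  obtain ⟨q, hq, rfl⟩ := hsupp hmem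
  exact hx.2 ⟨q, ⟨Ioo_subset_Icc_self hq.1, hS' q hq hx.1, hq.2.2.le⟩, rfl⟩

end IsChartOn

lemma inner_cross_cross (p e : E3) :
    ⟪cross e (cross p e), p⟫ = ‖e‖ ^ 2 * ‖p‖ ^ 2 - ⟪p, e⟫ ^ 2 := by
  rw [← real_inner_self_eq_norm_sq, ← real_inner_self_eq_norm_sq, inner_cross_eq_coord]
  simp only [inner_eq_coord, cross, cross_apply, Matrix.cons_val]
  ring

lemma exists_orthogonal_unit (p : E3) : ∃ e : E3, ‖e‖ = 1 ∧ ⟪p, e⟫ = 0 := by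
  have hrank : 0 < Module.finrank ℝ (ℝ ∙ p)ᗮ := by
    have hsum := Submodule.finrank_add_finrank_orthogonal (ℝ ∙ p)
    have hspan : Module.finrank ℝ (ℝ ∙ p) ≤ 1 := by
      simpa using finrank_span_le_card (R := ℝ) ({p} : Set E3)
    rw [finrank_euclideanSpace_fin] at hsum
    omega
  have : Nontrivial (ℝ ∙ p)ᗮ := Module.nontrivial_of_finrank_pos hrank
  obtain ⟨e, he⟩ := exists_norm_eq (ℝ ∙ p)ᗮ zero_le_one
  exact ⟨e, he, Submodule.mem_orthogonal_singleton_iff_inner_right.1 e.2⟩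

lemma exists_nhds_integral_surfDiv_eq_zero {S : Set Sph} (hSo : IsOpen S) {p : Sph} (hp : p ∈ S) :
    ∃ W, IsOpen W ∧ p ∈ W ∧ ∀ f : Sph → E3, IsDivField f S → tsupport f ⊆ W →
      ∫ x in S, surfDiv f x ∂area = 0 := by
  obtain ⟨e, he, hpe⟩ := exists_orthogonal_unit p
  let c : ℝ → E3 := fun s => p + s • e
  have hc : ContDiff ℝ 1 c := contDiff_const.add (contDiff_id.smul contDiff_const)
  have hc' : deriv c 0 = e :=
    (((hasDerivAt_id (0 : ℝ)).smul_const e).const_add (p : E3)).deriv.trans (one_smul ℝ e)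
  have hcenter : patch c (cross p e) (0, 0) = p := by simp [patch, ruled, c, radial_coe]
  have hJ : 0 < surfJacobian (ruled c (cross p e)) (0, 0) := by
    rw [surfJacobian_ruled hc, hc']
    simp [c, inner_cross_cross, he, hpe]
  have hN : patch c (cross p e) ⁻¹' S ∈ 𝓝 (0, 0) :=
    (continuousAt_patch hc hJ.ne').preimage_mem_nhds
      (hSo.mem_nhds (by rwa [hcenter]))
  obtain ⟨δ, -, hchart, hbox⟩ := exists_isChartOn hc one_pos hJ hN
  have hδ : -δ < δ := by linarith [hchart.pos]
  refine ⟨_, hchart.isOpen_image, ⟨_, hchart.center_mem, hcenter⟩, fun f hf hsupp => ?_⟩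
  rw [hchart.setIntegral_surfDiv (left_mem_Ico.2 hδ) hSo (fun q hq _ => hbox hq)
    (fun q hq _ => hq.2.1) hf hsupp]
  refine intervalIntegral.integral_zero_ae (Eventually.of_forall fun s hs => ?_)
  have hs' : s ∈ Icc (0 - δ) (0 + δ) := by
    rw [uIoc_of_le (by linarith)] at hs
    exact Ioc_subset_Icc_self hs
  rw [fluxField_eq_zero, inner_zero_left]
  exact hchart.apply_eq_zero hsupp ⟨hs', left_mem_Icc.2 hδ.le⟩ (by simp [openBox])

/-! ### Simple closed curves on the sphere -/

lemma lineIntegral_eq_integral_inner_velocity (γ : ℝ → Sph) (L : ℝ) (V : Sph → E3) :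
    lineIntegral γ L V = ∫ s in (0 : ℝ)..L, ⟪V (γ s), velocity γ s⟫ := by
  refine intervalIntegral.integral_congr fun s _ => ?_
  rcases eq_or_ne (velocity γ s) 0 with h | h
  · simp [h]
  · simp only [unitTangent, real_inner_smul_right]
    field_simp [norm_ne_zero_iff.2 h]

lemma inner_velocity {γ : ℝ → Sph} (hγ : Differentiable ℝ fun s => (γ s : E3)) (s : ℝ) :
    ⟪(γ s : E3), velocity γ s⟫ = 0 := by
  have hsq := (hγ s).hasDerivAt.norm_sq
  simp only [norm_coe_sph] at hsq
  simpa [velocity] using hsq.unique (hasDerivAt_const s _)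

/-- The unit normal `e_r × t` of the curve `γ` in the sphere. -/
def leftNormal (γ : ℝ → Sph) (s : ℝ) : E3 := cross (γ s) (unitTangent γ s)

namespace IsSimpleClosedCurve

variable {γ : ℝ → Sph} {L : ℝ}

lemma continuous (hγ : IsSimpleClosedCurve γ L) : Continuous γ :=
  continuous_induced_rng.2 hγ.contDiff.continuous

lemma continuous_velocity (hγ : IsSimpleClosedCurve γ L) : Continuous (velocity γ) :=
  hγ.contDiff.continuous_deriv le_rfl

lemma periodic_velocity (hγ : IsSimpleClosedCurve γ L) : Function.Periodic (velocity γ) L := by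
  intro s
  simp only [velocity, ← deriv_comp_add_const, hγ.periodic _]

lemma apply_toIcoMod (hγ : IsSimpleClosedCurve γ L) (a s : ℝ) :
    γ (toIcoMod hγ.pos a s) = γ s := by
  rw [toIcoMod, hγ.periodic.sub_zsmul_eq]

lemma injOn_Ico (hγ : IsSimpleClosedCurve γ L) (a : ℝ) : InjOn γ (Ico a (a + L)) := by
  intro s hs s' hs' h
  have hmem : ∀ r, toIcoMod hγ.pos 0 r ∈ Ico 0 L := fun r => by
    simpa using toIcoMod_mem_Ico hγ.pos 0 r
  have hmod : toIcoMod hγ.pos 0 s = toIcoMod hγ.pos 0 s' :=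
    hγ.injOn (hmem s) (hmem s') (by rw [hγ.apply_toIcoMod, hγ.apply_toIcoMod, h])
  rw [toIcoMod_eq_toIcoMod] at hmod
  rw [← (toIcoMod_eq_self hγ.pos).2 hs, ← (toIcoMod_eq_self hγ.pos).2 hs', toIcoMod_eq_toIcoMod]
  exact hmod

lemma eq_of_abs_sub_lt (hγ : IsSimpleClosedCurve γ L) {s s' : ℝ} (h : γ s = γ s')
    (hs : |s - s'| < L) : s = s' := by
  rw [abs_lt] at hs
  refine hγ.injOn_Ico (min s s') ⟨min_le_left _ _, ?_⟩ ⟨min_le_right _ _, ?_⟩ h <;>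
    rw [← min_add_add_right, lt_min_iff] <;> constructor <;> linarith [hγ.pos]

lemma surfJacobian_ruled_leftNormal_pos (hγ : IsSimpleClosedCurve γ L) (s : ℝ) :
    0 < surfJacobian (ruled (fun r => (γ r : E3)) (leftNormal γ s)) (s, 0) := by
  have hv := norm_pos_iff.2 (hγ.velocity_ne_zero s)
  have hcross : ∀ (r : ℝ) (a b : E3), cross a (r • b) = r • cross a b := fun r a b =>
    (crossCLM a).map_smul r b
  rw [surfJacobian_ruled hγ.contDiff, leftNormal, unitTangent, hcross, hcross,
    real_inner_smul_left]
  refine mul_pos (inv_pos.2 hv) ?_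
  change 0 < ⟪cross (velocity γ s) (cross (γ s) (velocity γ s)), γ s⟫
  rw [inner_cross_cross, inner_velocity (hγ.contDiff.differentiable one_ne_zero), norm_coe_sph]
  simpa using pow_pos hv 2

lemma patch_center (γ : ℝ → Sph) (n : E3) (s : ℝ) :
    patch (fun r => (γ r : E3)) n (s, 0) = γ s := by
  simp [patch, ruled, radial_coe]

/-- The chart is so small that it does not meet the far parts of the curve. -/
lemma exists_isChartOn (hγ : IsSimpleClosedCurve γ L) (s₀ : ℝ) :
    ∃ δ ≤ L / 2, IsChartOn (fun r => (γ r : E3)) (leftNormal γ s₀) s₀ δ ∧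
      ∀ q ∈ closedBox s₀ δ, patch (fun r => (γ r : E3)) (leftNormal γ s₀) q ∈ range γ →
        q.2 = 0 := by
  have hJ := hγ.surfJacobian_ruled_leftNormal_pos s₀
  obtain ⟨ε, -, hε, -⟩ := SphereRepr.exists_isChartOn hγ.contDiff one_pos hJ univ_mem
  have hfar : IsClosed (γ '' Icc (s₀ + ε) (s₀ - ε + L)) :=
    (isCompact_Icc.image hγ.continuous).isClosed
  have hs₀ : γ s₀ ∉ γ '' Icc (s₀ + ε) (s₀ - ε + L) := by
    rintro ⟨s, hs, h⟩
    have := hγ.eq_of_abs_sub_lt h (by rw [abs_lt]; constructor <;> linarith [hs.1, hs.2, hε.pos])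
    linarith [hs.1, hε.pos]
  have hN : patch _ (leftNormal γ s₀) ⁻¹' (γ '' Icc (s₀ + ε) (s₀ - ε + L))ᶜ ∈ 𝓝 (s₀, 0) :=
    (continuousAt_patch hγ.contDiff hJ.ne').preimage_mem_nhds
      (hfar.isOpen_compl.mem_nhds (by rwa [patch_center]))
  obtain ⟨δ, hδ, hchart, hbox⟩ := SphereRepr.exists_isChartOn hγ.contDiff
    (lt_min hε.pos (half_pos hγ.pos)) hJ hN
  refine ⟨δ, hδ.trans (min_le_right _ _), hchart, ?_⟩
  rintro q hq ⟨s, hs⟩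
  rw [← hγ.apply_toIcoMod (s₀ - ε)] at hs
  have hmem := toIcoMod_mem_Ico hγ.pos (s₀ - ε) s
  have hnear : toIcoMod hγ.pos (s₀ - ε) s < s₀ + ε := by
    by_contra! hcon
    exact hbox hq ⟨_, ⟨hcon, hmem.2.le⟩, hs⟩
  rw [← patch_center γ (leftNormal γ s₀)] at hs
  rw [← hε.injOn ⟨⟨hmem.1, hnear.le⟩, by simp [hε.pos.le]⟩
    (closedBox_mono (hδ.trans (min_le_left _ _)) hq) hs]

lemma lineIntegral_eq_of_forall_eq_zero (hγ : IsSimpleClosedCurve γ L) {V : Sph → E3} {s₀ δ : ℝ}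
    (hδ : 0 < δ) (hδL : δ ≤ L / 2)
    (hV : ∀ s ∈ Ioc (s₀ - L / 2) (s₀ + L / 2), s ∉ Ioc (s₀ - δ) (s₀ + δ) → V (γ s) = 0) :
    lineIntegral γ L V = ∫ s in (s₀ - δ)..(s₀ + δ), ⟪V (γ s), velocity γ s⟫ := by
  have hper : Function.Periodic (fun s => ⟪V (γ s), velocity γ s⟫) L := fun s => by
    simp only [hγ.periodic s, hγ.periodic_velocity s]
  have hshift := hper.intervalIntegral_add_eq 0 (s₀ - L / 2)
  rw [zero_add, show s₀ - L / 2 + L = s₀ + L / 2 by ring] at hshift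
  rw [lineIntegral_eq_integral_inner_velocity, hshift,
    intervalIntegral.integral_of_le (by linarith), intervalIntegral.integral_of_le (by linarith)]
  refine setIntegral_eq_of_subset_of_forall_sdiff_eq_zero measurableSet_Ioc
    (Ioc_subset_Ioc (by linarith) (by linarith)) fun s hs => ?_
  rw [hV s hs.1 hs.2, inner_zero_left]

end IsSimpleClosedCurve

namespace Divides

variable {γ : ℝ → Sph} {S₁ S₂ : Set Sph}

lemma notMem_range_of_mem (hS : Divides γ S₁ S₂) {x : Sph} (hx : x ∈ S₂) : x ∉ range γ := by
  have : x ∈ (range γ)ᶜ := hS.union ▸ Or.inr hx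
  exact this

lemma subset_of_isPreconnected (hS : Divides γ S₁ S₂) {T : Set Sph} (hT : IsPreconnected T)
    (hTγ : Disjoint T (range γ)) (hTS : (T ∩ S₂).Nonempty) : T ⊆ S₂ :=
  hT.subset_right_of_subset_union hS.isOpen₁ hS.isOpen₂ hS.disjoint
    (by rw [hS.union]; exact hTγ.subset_compl_right) hTS

/-- The upper half of the chart lies in `S₂` by the orientation of `γ`; the lower half does not,
because `γ s₀` is also in the closure of `S₁`. -/
lemma patch_mem_iff (hS : Divides γ S₁ S₂) (hor : PositivelyOriented γ S₂) {s₀ δ : ℝ}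
    (hchart : IsChartOn (fun r => (γ r : E3)) (leftNormal γ s₀) s₀ δ)
    (hcurve : ∀ q ∈ closedBox s₀ δ,
      patch (fun r => (γ r : E3)) (leftNormal γ s₀) q ∈ range γ → q.2 = 0)
    {q : ℝ × ℝ} (hq : q ∈ closedBox s₀ δ) :
    patch (fun r => (γ r : E3)) (leftNormal γ s₀) q ∈ S₂ ↔ 0 < q.2 := by
  set P := patch (fun r => (γ r : E3)) (leftNormal γ s₀) with hP
  have hδ := hchart.pos
  have hcurve₀ : ∀ q : ℝ × ℝ, q.2 = 0 → P q ∈ range γ := fun q hq => by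
    rw [← Prod.mk.eta (p := q), hq, hP, IsSimpleClosedCurve.patch_center]
    exact mem_range_self _
  have hhalf : ∀ J ⊆ Icc (-δ) δ, IsPreconnected J → 0 ∉ J →
      (∃ q ∈ Icc (s₀ - δ) (s₀ + δ) ×ˢ J, P q ∈ S₂) →
      ∀ q ∈ Icc (s₀ - δ) (s₀ + δ) ×ˢ J, P q ∈ S₂ := by
    rintro J hJ hJc hJ0 ⟨q₀, hq₀, hqS⟩
    have hsub : Icc (s₀ - δ) (s₀ + δ) ×ˢ J ⊆ closedBox s₀ δ := prod_mono_right hJ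
    refine image_subset_iff.1 (hS.subset_of_isPreconnected
      ((isPreconnected_Icc.prod hJc).image _ (hchart.continuousOn.mono hsub)) ?_
      ⟨_, mem_image_of_mem P hq₀, hqS⟩)
    rw [disjoint_left]
    rintro _ ⟨q, hq, rfl⟩ hmem
    exact hJ0 (hcurve q (hsub hq) hmem ▸ hq.2)
  have hupper : ∀ q ∈ closedBox s₀ δ, 0 < q.2 → P q ∈ S₂ := by
    obtain ⟨ε, hεS, hε⟩ := ((hor s₀).and (Ioc_mem_nhdsGT hδ)).exists
    exact fun q hq hq0 => hhalf (Ioc 0 δ) (fun t ht => ⟨by linarith [ht.1], ht.2⟩)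
      isPreconnected_Ioc (by simp) ⟨(s₀, ε), ⟨by simp [hδ.le], hε⟩, hεS⟩ q
      ⟨hq.1, hq0, hq.2.2⟩
  refine ⟨fun hqS => ?_, hupper q hq⟩
  by_contra! hq0
  have hneg : q.2 < 0 := hq0.lt_of_ne fun h => hS.notMem_range_of_mem hqS (hcurve₀ q h)
  have hlower := hhalf (Ico (-δ) 0) (fun t ht => ⟨ht.1, by linarith [ht.2]⟩)
    isPreconnected_Ico (by simp) ⟨q, ⟨hq.1, hq.2.1, hneg⟩, hqS⟩
  have hclosure : γ s₀ ∈ closure S₁ :=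
    frontier_subset_closure (hS.frontier₁ ▸ mem_range_self s₀)
  obtain ⟨_, ⟨r, hr, rfl⟩, hrS⟩ := mem_closure_iff.1 hclosure _ hchart.isOpen_image
    ⟨_, hchart.center_mem, IsSimpleClosedCurve.patch_center γ _ s₀⟩
  have hrS₂ : P r ∉ S₂ := disjoint_left.1 hS.disjoint hrS
  have hrγ : P r ∉ range γ := by
    have : P r ∈ (range γ)ᶜ := hS.union ▸ Or.inl hrS
    exact this
  rcases lt_trichotomy r.2 0 with h | h | h
  · exact hrS₂ (hlower r ⟨Ioo_subset_Icc_self hr.1, hr.2.1.le, h⟩)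
  · exact hrγ (hcurve₀ r h)
  · exact hrS₂ (hupper r (openBox_subset_closedBox hr) h)

end Divides

lemma exists_nhds_integral_surfDiv_eq_lineIntegral {γ : ℝ → Sph} {L : ℝ} {S₁ S₂ : Set Sph}
    (hγ : IsSimpleClosedCurve γ L) (hS : Divides γ S₁ S₂) (hor : PositivelyOriented γ S₂)
    (s₀ : ℝ) :
    ∃ W, IsOpen W ∧ γ s₀ ∈ W ∧ ∀ f : Sph → E3, IsDivField f S₂ → tsupport f ⊆ W →
      ∫ x in S₂, surfDiv f x ∂area = lineIntegral γ L fun x => cross x (f x) := by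
  obtain ⟨δ, hδL, hchart, hcurve⟩ := hγ.exists_isChartOn s₀
  have hside := fun q hq => hS.patch_mem_iff hor hchart hcurve (q := q) hq
  have hδ := hchart.pos
  refine ⟨_, hchart.isOpen_image, ⟨_, hchart.center_mem, IsSimpleClosedCurve.patch_center γ _ _⟩,
    fun f hf hsupp => ?_⟩
  rw [hchart.setIntegral_surfDiv ⟨neg_nonpos.2 hδ.le, hδ⟩ hS.isOpen₂
    (fun q hq => (hside q hq).2) (fun q hq => (hside q (openBox_subset_closedBox hq)).1) hf hsupp,
    hγ.lineIntegral_eq_of_forall_eq_zero (s₀ := s₀) hδ hδL]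
  · simp only [ruled, zero_smul, add_zero, fluxField, fieldExt_coe, velocity]
  · intro s hs hsδ
    have hfs : f (γ s) = 0 := by
      refine image_eq_zero_of_notMem_tsupport fun hmem => ?_
      obtain ⟨⟨r, t⟩, hr, hrs⟩ := hsupp hmem
      obtain rfl : t = 0 := hcurve _ (openBox_subset_closedBox hr) (hrs ▸ mem_range_self s)
      rw [IsSimpleClosedCurve.patch_center] at hrs
      refine hsδ (hγ.eq_of_abs_sub_lt hrs ?_ ▸ Ioo_subset_Ioc_self hr.1)
      rw [abs_lt]
      constructor <;> linarith [hr.1.1, hr.1.2, hs.1, hs.2]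
    exact (congrArg (crossCLM (γ s)) hfs).trans (map_zero _)

/-! ### The divergence theorem -/

lemma fieldExt_fun_smul (φ : Sph → ℝ) (f : Sph → E3) :
    fieldExt (fun x => φ x • f x) = fun y => homExt φ y • fieldExt f y := by
  ext1 y
  exact smul_comm _ _ _

lemma surfDiv_smul {φ : Sph → ℝ} {f : Sph → E3} {x : Sph}
    (hφ : DifferentiableAt ℝ (homExt φ) x) (hf : DifferentiableAt ℝ (fieldExt f) x) :
    surfDiv (fun z => φ z • f z) x = φ x * surfDiv f x + ⟪surfGrad φ x, f x⟫ := by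
  rw [surfDiv, fieldExt_fun_smul, divergence_smul hφ hf, homExt_coe, fieldExt_coe, surfGrad,
    inner_gradient_left]
  rfl

lemma surfDiv_sum {ι : Type*} {s : Finset ι} {f : ι → Sph → E3} {x : Sph}
    (hf : ∀ i ∈ s, DifferentiableAt ℝ (fieldExt (f i)) x) :
    surfDiv (fun z => ∑ i ∈ s, f i z) x = ∑ i ∈ s, surfDiv (f i) x := by
  simp only [surfDiv, ← divergence_sum hf]
  exact congrArg (divergence · (x : E3)) (funext fun y => by simp [fieldExt, Finset.smul_sum])

lemma continuousOn_surfGrad {φ : Sph → ℝ} {S : Set Sph} (hS : IsOpen S)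
    (hφ : ContMDiffOn (𝓡 2) 𝓘(ℝ, ℝ) 1 φ S) : ContinuousOn (surfGrad φ) S := by
  have hfderiv : ContinuousOn (fderiv ℝ (homExt φ)) (cone S) :=
    (contDiffOn_homExt hφ).continuousOn_fderiv_of_isOpen (isOpen_cone hS) le_rfl
  exact (InnerProductSpace.toDual ℝ E3).symm.continuous.comp_continuousOn
    (hfderiv.comp continuous_subtype_val.continuousOn fun x hx => coe_mem_cone.2 hx)

instance : IsFiniteMeasure area := by
  unfold area
  infer_instance

lemma IsC1UpToBoundary.of_contMDiff {φ : Sph → ℝ} (hφ : ContMDiff (𝓡 2) 𝓘(ℝ, ℝ) 1 φ)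
    (S : Set Sph) : IsC1UpToBoundary φ S where
  contMDiffOn := hφ.contMDiffOn
  continuousOn := hφ.continuous.continuousOn
  exists_grad := ⟨surfGrad φ,
    (continuousOn_surfGrad isOpen_univ hφ.contMDiffOn).mono (subset_univ _), fun _ _ => rfl⟩

lemma IsC1UpToBoundary.differentiableAt_homExt {φ : Sph → ℝ} {S : Set Sph}
    (hφ : IsC1UpToBoundary φ S) (hS : IsOpen S) {x : Sph} (hx : x ∈ S) :
    DifferentiableAt ℝ (homExt φ) x :=
  ((contDiffOn_homExt hφ.contMDiffOn).differentiableOn one_ne_zero).differentiableAt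
    ((isOpen_cone hS).mem_nhds (coe_mem_cone.2 hx))

namespace IsDivField

variable {φ : Sph → ℝ} {f : Sph → E3} {S : Set Sph}

lemma surfDiv_smul (hf : IsDivField f S) (hS : IsOpen S) (hφ : IsC1UpToBoundary φ S) {x : Sph}
    (hx : x ∈ S) :
    surfDiv (fun z => φ z • f z) x = φ x * surfDiv f x + ⟪surfGrad φ x, f x⟫ :=
  SphereRepr.surfDiv_smul (hφ.differentiableAt_homExt hS hx)
    (hf.differentiableAt_fieldExt hS (coe_mem_cone.2 hx))

protected lemma smul (hf : IsDivField f S) (hS : IsOpen S) (hφ : IsC1UpToBoundary φ S) :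
    IsDivField (fun x => φ x • f x) S where
  continuousOn := hφ.continuousOn.smul hf.continuousOn
  contDiffOn := by
    rw [fieldExt_fun_smul]
    exact (contDiffOn_homExt hφ.contMDiffOn).smul hf.contDiffOn
  integrable := by
    obtain ⟨G, hGc, hG⟩ := hφ.exists_grad
    have hK : IsCompact (closure S) := isClosed_closure.isCompact
    have hsum : IntegrableOn (fun x => φ x * surfDiv f x + ⟪G x, f x⟫) S area :=
      (hf.integrable.continuousOn_mul_of_subset hφ.continuousOn hK hS.measurableSet
        subset_closure).add
        (((hGc.inner hf.continuousOn).integrableOn_compact hK).mono_set subset_closure)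
    refine hsum.congr_fun (fun x hx => ?_) hS.measurableSet
    simp only [hf.surfDiv_smul hS hφ hx, hG hx]

end IsDivField

lemma IsDivField.exists_sum_eq {f : Sph → E3} {S : Set Sph} (hS : IsOpen S)
    (hf : IsDivField f S) {W : Sph → Set Sph} (hWo : ∀ p, IsOpen (W p)) (hW : ∀ p, p ∈ W p) :
    ∃ (t : Finset Sph) (g : t → Sph → E3),
      (∀ p, IsDivField (g p) S ∧ tsupport (g p) ⊆ W p) ∧ f = fun x => ∑ p, g p x := by
  obtain ⟨t, ht⟩ := isCompact_univ.elim_finite_subcover W hWo fun p _ => mem_iUnion.2 ⟨p, hW p⟩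
  obtain ⟨ρ, hρ⟩ := SmoothPartitionOfUnity.exists_isSubordinate (𝓡 2) isClosed_univ
    (fun p : t => W p) (fun p => hWo p) fun x hx => by simpa using ht hx
  refine ⟨t, fun p x => ρ p x • f x, fun p =>
    ⟨hf.smul hS (.of_contMDiff ?_ S), ?_⟩, ?_⟩
  · exact (ρ p).contMDiff.of_le (by exact_mod_cast le_top)
  · exact (tsupport_smul_subset_left (ρ p) f).trans (hρ p)
  · ext1 x
    rw [← Finset.sum_smul, ← finsum_eq_sum_of_fintype, ρ.sum_eq_one (mem_univ x), one_smul]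

lemma IsDivField.setIntegral_surfDiv_sum {ι : Type*} {s : Finset ι} {g : ι → Sph → E3}
    {S : Set Sph} (hS : IsOpen S) (hg : ∀ i ∈ s, IsDivField (g i) S) :
    ∫ x in S, surfDiv (fun z => ∑ i ∈ s, g i z) x ∂area =
      ∑ i ∈ s, ∫ x in S, surfDiv (g i) x ∂area := by
  rw [← integral_finsetSum _ fun i hi => (hg i hi).integrable]
  exact setIntegral_congr_fun hS.measurableSet fun x hx =>
    surfDiv_sum fun i hi => (hg i hi).differentiableAt_fieldExt hS (coe_mem_cone.2 hx)

theorem integral_surfDiv_eq_zero {f : Sph → E3} (hf : IsDivField f univ) :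
    ∫ x, surfDiv f x ∂area = 0 := by
  choose W hWo hpW hW using fun p : Sph =>
    exists_nhds_integral_surfDiv_eq_zero isOpen_univ (mem_univ p)
  obtain ⟨t, g, hg, rfl⟩ := hf.exists_sum_eq isOpen_univ hWo hpW
  rw [← setIntegral_univ, IsDivField.setIntegral_surfDiv_sum isOpen_univ fun p _ => (hg p).1]
  exact Finset.sum_eq_zero fun p _ => hW p _ (hg p).1 (hg p).2

lemma IsSimpleClosedCurve.intervalIntegrable {γ : ℝ → Sph} {L : ℝ}
    (hγ : IsSimpleClosedCurve γ L) {V : Sph → E3} (hV : ContinuousOn V (range γ)) (a b : ℝ) :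
    IntervalIntegrable (fun s => ⟪V (γ s), velocity γ s⟫) volume a b :=
  ((hV.comp_continuous hγ.continuous mem_range_self).inner
    hγ.continuous_velocity).intervalIntegrable a b

lemma IsSimpleClosedCurve.lineIntegral_sum {γ : ℝ → Sph} {L : ℝ}
    (hγ : IsSimpleClosedCurve γ L) {ι : Type*} {s : Finset ι} {V : ι → Sph → E3}
    (hV : ∀ i ∈ s, ContinuousOn (V i) (range γ)) :
    lineIntegral γ L (fun x => ∑ i ∈ s, V i x) = ∑ i ∈ s, lineIntegral γ L (V i) := by
  simp only [lineIntegral_eq_integral_inner_velocity, sum_inner]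
  exact intervalIntegral.integral_finsetSum fun i hi => hγ.intervalIntegrable (hV i hi) _ _

lemma lineIntegral_eq_zero {γ : ℝ → Sph} {L : ℝ} {V : Sph → E3} (hV : ∀ s, V (γ s) = 0) :
    lineIntegral γ L V = 0 := by
  simp [lineIntegral, hV]

namespace Divides

variable {γ : ℝ → Sph} {L : ℝ} {S₁ S₂ : Set Sph}

lemma range_subset_closure (hS : Divides γ S₁ S₂) : range γ ⊆ closure S₂ :=
  hS.frontier₂ ▸ frontier_subset_closure

/-- The local form of the divergence theorem, at points of `S₁`, of the curve and of `S₂`. -/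
lemma exists_nhds_integral_surfDiv_eq_lineIntegral (hS : Divides γ S₁ S₂)
    (hγ : IsSimpleClosedCurve γ L) (hor : PositivelyOriented γ S₂) (p : Sph) :
    ∃ W, IsOpen W ∧ p ∈ W ∧ ∀ f : Sph → E3, IsDivField f S₂ → tsupport f ⊆ W →
      ∫ x in S₂, surfDiv f x ∂area = lineIntegral γ L fun x => cross x (f x) := by
  have hline : ∀ {f : Sph → E3} {W : Set Sph}, tsupport f ⊆ W → W ⊆ (range γ)ᶜ →
      lineIntegral γ L (fun x => cross x (f x)) = 0 := fun {f W} hf hW =>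
    lineIntegral_eq_zero fun s => by
      rw [image_eq_zero_of_notMem_tsupport fun h => hW (hf h) (mem_range_self s)]
      exact map_zero (crossCLM (γ s))
  by_cases hp : p ∈ range γ
  · obtain ⟨s₀, rfl⟩ := hp
    exact SphereRepr.exists_nhds_integral_surfDiv_eq_lineIntegral hγ hS hor s₀
  rcases hS.union.symm.subset hp with hp | hp
  · refine ⟨S₁, hS.isOpen₁, hp, fun f _ hf => ?_⟩
    rw [hline hf (hS.union ▸ subset_union_left)]
    exact setIntegral_eq_zero_of_forall_eq_zero fun x hx =>
      surfDiv_eq_zero_of_notMem_tsupport fun h => disjoint_left.1 hS.disjoint (hf h) hx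
  · obtain ⟨W, hWo, hpW, hW⟩ := exists_nhds_integral_surfDiv_eq_zero hS.isOpen₂ hp
    refine ⟨W ∩ S₂, hWo.inter hS.isOpen₂, ⟨hpW, hp⟩, fun f hf hfW => ?_⟩
    rw [hline hfW (inter_subset_right.trans (hS.union ▸ subset_union_right))]
    exact hW f hf (hfW.trans inter_subset_left)

theorem integral_surfDiv_eq_lineIntegral (hS : Divides γ S₁ S₂)
    (hγ : IsSimpleClosedCurve γ L) (hor : PositivelyOriented γ S₂) {f : Sph → E3}
    (hf : IsDivField f S₂) :
    ∫ x in S₂, surfDiv f x ∂area = lineIntegral γ L fun x => cross x (f x) := by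
  choose W hWo hpW hW using hS.exists_nhds_integral_surfDiv_eq_lineIntegral hγ hor
  obtain ⟨t, g, hg, rfl⟩ := hf.exists_sum_eq hS.isOpen₂ hWo hpW
  have hcross : ∀ x : Sph, cross x (∑ p, g p x) = ∑ p, cross x (g p x) := fun x =>
    map_sum (crossCLM x) _ _
  simp only [hcross]
  rw [IsDivField.setIntegral_surfDiv_sum hS.isOpen₂ fun p _ => (hg p).1, hγ.lineIntegral_sum]
  · exact Finset.sum_congr rfl fun p _ => hW p _ (hg p).1 (hg p).2
  · exact fun p _ => crossCLM.continuous.comp_continuousOn continuous_subtype_val.continuousOn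
      |>.clm_apply ((hg p).1.continuousOn.mono hS.range_subset_closure)

end Divides

/-! ### Gradient and Laplacian -/

section Gradient

variable {E : Type*} [NormedAddCommGroup E] [InnerProductSpace ℝ E]

lemma hasFDerivAt_norm_zpow (k : ℤ) {y : E} (hy : y ≠ 0) :
    HasFDerivAt (fun z : E => ‖z‖ ^ k) ((k * ‖y‖ ^ (k - 2)) • innerSL ℝ y) y := by
  have hy' : ‖y‖ ≠ 0 := norm_ne_zero_iff.2 hy
  have hnorm : HasFDerivAt (fun z : E => ‖z‖) (‖y‖⁻¹ • innerSL ℝ y) y := by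
    have hd := ((contDiffAt_norm (n := 1) ℝ hy).differentiableAt one_ne_zero).hasFDerivAt
    have hsq := (hd.pow 2).unique (hasStrictFDerivAt_norm_sq y).hasFDerivAt
    refine hd.congr_fderiv ?_
    ext v
    have hv := DFunLike.congr_fun hsq v
    simp only [Nat.add_one_sub_one, pow_one, nsmul_eq_mul, Nat.cast_ofNat, _root_.smul_apply,
      smul_eq_mul, innerSL_apply_apply] at hv ⊢
    rw [eq_inv_mul_iff_mul_eq₀ hy']
    linarith
  refine ((hasDerivAt_zpow k ‖y‖ (Or.inl hy')).comp_hasFDerivAt y hnorm).congr_fderiv ?_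
  rw [smul_smul, mul_assoc, ← zpow_sub_one₀ hy', sub_sub]
  norm_num

variable [CompleteSpace E]

/-- The Riesz isomorphism, as a linear instead of a conjugate-linear map. -/
def rieszEquiv : StrongDual ℝ E ≃L[ℝ] E :=
  (InnerProductSpace.toDual ℝ E).symm.toContinuousLinearEquiv

lemma gradient_eq_rieszEquiv_comp (U : E → ℝ) : gradient U = rieszEquiv ∘ fderiv ℝ U := rfl

lemma contDiffOn_gradient {U : E → ℝ} {O : Set E} (hO : IsOpen O) (hU : ContDiffOn ℝ 2 U O) :
    ContDiffOn ℝ 1 (gradient U) O :=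
  rieszEquiv.contDiff.comp_contDiffOn (hU.fderiv_of_isOpen hO (by norm_num))

lemma gradient_comp {h : ℝ → ℝ} {h' : ℝ} {U : E → ℝ} {y : E} (hh : HasDerivAt h h' (U y))
    (hU : DifferentiableAt ℝ U y) : gradient (fun z => h (U z)) y = h' • gradient U y := by
  have hcomp : fderiv ℝ (fun z => h (U z)) y = h' • fderiv ℝ U y :=
    (hh.comp_hasFDerivAt y hU.hasFDerivAt).fderiv
  rw [gradient_eq_rieszEquiv_comp, Function.comp_apply, hcomp, map_smul]
  rfl

lemma differentiableAt_gradient {U : E → ℝ} {y : E} (hU : ContDiffAt ℝ 2 U y) :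
    DifferentiableAt ℝ (gradient U) y :=
  rieszEquiv.differentiableAt.comp y
    ((hU.fderiv_right (m := 1) (by norm_num)).differentiableAt one_ne_zero)

variable [FiniteDimensional ℝ E]

lemma divergence_gradient (U : E → ℝ) (y : E) :
    divergence (gradient U) y = Laplacian.laplacian U y := by
  rw [InnerProductSpace.laplacian_eq_iteratedFDeriv_stdOrthonormalBasis, divergence,
    LinearMap.trace_eq_sum_inner _ (stdOrthonormalBasis ℝ E), gradient_eq_rieszEquiv_comp,
    rieszEquiv.comp_fderiv]
  refine Finset.sum_congr rfl fun i _ => ?_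
  rw [real_inner_comm, iteratedFDeriv_two_apply]
  exact InnerProductSpace.toDual_symm_apply

lemma laplacian_comp {h h' : ℝ → ℝ} {h'' : ℝ} {U : E → ℝ} {y : E} (hU : ContDiffAt ℝ 2 U y)
    (hh : ∀ᶠ t in 𝓝 (U y), HasDerivAt h (h' t) t) (hh' : HasDerivAt h' h'' (U y)) :
    Laplacian.laplacian (fun z => h (U z)) y =
      h' (U y) * Laplacian.laplacian U y + h'' * ‖gradient U y‖ ^ 2 := by
  have hgrad : gradient (fun z => h (U z)) =ᶠ[𝓝 y] fun z => h' (U z) • gradient U z := by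
    filter_upwards [hU.continuousAt.eventually hh, hU.eventually (by simp)] with z hz hUz
    exact gradient_comp hz (hUz.differentiableAt two_ne_zero)
  have hhU : HasFDerivAt (fun z => h' (U z)) (h'' • fderiv ℝ U y) y :=
    hh'.comp_hasFDerivAt y (hU.differentiableAt two_ne_zero).hasFDerivAt
  rw [← divergence_gradient, divergence_congr hgrad,
    divergence_smul hhU.differentiableAt (differentiableAt_gradient hU), divergence_gradient,
    hhU.fderiv, ← real_inner_self_eq_norm_sq, inner_gradient_left]
  rfl

end Gradient

lemma fieldExt_surfGrad (u : Sph → ℝ) {y : E3} (hy : y ≠ 0) :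
    fieldExt (surfGrad u) y = ‖y‖ ^ (-1 : ℤ) • gradient (homExt u) y := by
  have hr : 0 < ‖y‖⁻¹ := inv_pos.2 (norm_pos_iff.2 hy)
  have h : fderiv ℝ (homExt u) (‖y‖⁻¹ • y) = ‖y‖ • fderiv ℝ (homExt u) y := by
    rw [fderiv_smul_of_homogeneous hr.ne' (k := 0), zero_sub, zpow_neg_one, inv_inv]
    filter_upwards [isOpen_ne.mem_nhds hy] with z hz
    rw [homExt, radial_smul hr hz, zpow_zero, one_smul, homExt]
  rw [fieldExt, surfGrad, coe_radial hy, gradient_eq_rieszEquiv_comp, Function.comp_apply, h,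
    map_smul, smul_smul, ← zpow_add_one₀ (norm_ne_zero_iff.2 hy)]
  rfl

lemma inner_surfGrad_self {u : Sph → ℝ} {x : Sph} (hu : DifferentiableAt ℝ (homExt u) x) :
    ⟪surfGrad u x, (x : E3)⟫ = 0 := by
  rw [surfGrad, inner_gradient_left, fderiv_apply_self_of_homogeneous (k := 0) _ hu]
  · simp
  · intro r hr
    rw [homExt, radial_smul hr (coe_sph_ne_zero x), zpow_zero, one_smul, homExt]

lemma surfDiv_surfGrad {u : Sph → ℝ} {x : Sph} (hu : ContDiffAt ℝ 2 (homExt u) x) :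
    surfDiv (surfGrad u) x = laplaceBeltrami u x := by
  have hx := coe_sph_ne_zero x
  have hext : fieldExt (surfGrad u) =ᶠ[𝓝 (x : E3)]
      fun y => ‖y‖ ^ (-1 : ℤ) • gradient (homExt u) y := by
    filter_upwards [isOpen_ne.mem_nhds hx] with y hy using fieldExt_surfGrad u hy
  have hradial : ⟪(x : E3), gradient (homExt u) x⟫ = 0 :=
    (real_inner_comm _ _).trans (inner_surfGrad_self (hu.differentiableAt two_ne_zero))
  rw [surfDiv, divergence_congr hext,
    divergence_smul (hasFDerivAt_norm_zpow (-1) hx).differentiableAt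
      (differentiableAt_gradient hu), divergence_gradient, (hasFDerivAt_norm_zpow (-1) hx).fderiv,
    _root_.smul_apply, innerSL_apply_apply, hradial]
  simp [laplaceBeltrami]

lemma IsC2On.contDiffAt_homExt {u : Sph → ℝ} {S : Set Sph} (hu : IsC2On u S) (hS : IsOpen S)
    {x : Sph} (hx : x ∈ S) : ContDiffAt ℝ 2 (homExt u) x :=
  (contDiffOn_homExt hu).contDiffAt ((isOpen_cone hS).mem_nhds (coe_mem_cone.2 hx))

lemma IsC2On.contDiffOn_fieldExt_surfGrad {u : Sph → ℝ} {S : Set Sph} (hu : IsC2On u S)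
    (hS : IsOpen S) : ContDiffOn ℝ 1 (fieldExt (surfGrad u)) (cone S) := by
  have hgrad := contDiffOn_gradient (isOpen_cone hS) (contDiffOn_homExt hu)
  have hnorm : ContDiffOn ℝ 1 (fun y : E3 => ‖y‖ ^ (-1 : ℤ)) (cone S) := fun y hy =>
    ((contDiffAt_norm ℝ hy.1).inv (norm_ne_zero_iff.2 hy.1)).contDiffWithinAt.congr
      (fun _ _ => zpow_neg_one _) (zpow_neg_one _)
  exact (hnorm.smul hgrad).congr fun y hy => fieldExt_surfGrad u hy.1

lemma IsC2On.continuousOn_laplaceBeltrami {u : Sph → ℝ} {S : Set Sph} (hu : IsC2On u S)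
    (hS : IsOpen S) : ContinuousOn (laplaceBeltrami u) S := by
  have hgrad : ContinuousOn (fderiv ℝ (gradient (homExt u))) (cone S) :=
    (contDiffOn_gradient (isOpen_cone hS) (contDiffOn_homExt hu)).continuousOn_fderiv_of_isOpen
      (isOpen_cone hS) le_rfl
  have htrace : Continuous fun A : E3 →L[ℝ] E3 => LinearMap.trace ℝ E3 A :=
    LinearMap.continuous_of_finiteDimensional
      (LinearMap.trace ℝ E3 ∘ₗ ContinuousLinearMap.coeLM ℝ)
  refine ((htrace.comp_continuousOn hgrad).comp continuous_subtype_val.continuousOn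
    fun x hx => coe_mem_cone.2 hx).congr fun x _ => ?_
  exact (divergence_gradient (homExt u) x).symm

lemma boundaryCurl_eq {u : Sph → ℝ} {G : Sph → E3} {S : Set Sph}
    (hGc : ContinuousOn G (closure S)) (hG : EqOn G (surfGrad u) S) {x : Sph}
    (hx : x ∈ closure S) : boundaryCurl u S x = cross (G x) x := by
  have hcross : ContinuousOn (fun z : Sph => cross (G z) z) (closure S) :=
    (crossCLM.continuous.comp_continuousOn hGc).clm_apply continuous_subtype_val.continuousOn
  refine extendFrom_eq hx ((((hcross x hx).mono subset_closure).tendsto).congr' ?_)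
  filter_upwards [self_mem_nhdsWithin] with z hz
  rw [surfCurl, hG hz]

/-! ### Green's formulas -/

lemma cross_eq_neg_cross (v w : E3) : cross v w = -cross w v :=
  congrArg (WithLp.toLp 2) (cross_anticomm w.ofLp v.ofLp).symm

lemma isDivField_of_eqOn_surfGrad {u : Sph → ℝ} {G : Sph → E3} {S : Set Sph} (hS : IsOpen S)
    (hu : IsC2On u S) (hGc : ContinuousOn G (closure S)) (hG : EqOn G (surfGrad u) S)
    (hΔ : IntegrableOn (laplaceBeltrami u) S area) :
    IsDivField G S ∧ EqOn (surfDiv G) (laplaceBeltrami u) S := by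
  have hdiv : EqOn (surfDiv G) (laplaceBeltrami u) S := fun x hx =>
    (surfDiv_congr (hG.eventuallyEq_of_mem (hS.mem_nhds hx))).trans
      (surfDiv_surfGrad (hu.contDiffAt_homExt hS hx))
  refine ⟨⟨hGc, ?_, hΔ.congr_fun hdiv.symm hS.measurableSet⟩, hdiv⟩
  exact (hu.contDiffOn_fieldExt_surfGrad hS).congr fun y hy => by
    rw [fieldExt, fieldExt, hG hy.2]

lemma IsC2On.continuous_surfGrad {v : Sph → ℝ} (hv : IsC2On v univ) : Continuous (surfGrad v) :=
  continuousOn_univ.1 (continuousOn_surfGrad isOpen_univ (hv.of_le one_le_two))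

lemma IsC2On.continuous_laplaceBeltrami {v : Sph → ℝ} (hv : IsC2On v univ) :
    Continuous (laplaceBeltrami v) :=
  continuousOn_univ.1 (hv.continuousOn_laplaceBeltrami isOpen_univ)

lemma integrable_area_of_continuous {v : Sph → ℝ} (hv : Continuous v) : Integrable v area :=
  hv.integrable_of_hasCompactSupport (HasCompactSupport.of_compactSpace v)

lemma integrableOn_of_continuousOn_closure {v : Sph → ℝ} {S : Set Sph}
    (hv : ContinuousOn v (closure S)) : IntegrableOn v S area :=
  (hv.integrableOn_compact isClosed_closure.isCompact).mono_set subset_closure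

lemma lineIntegral_neg (γ : ℝ → Sph) (L : ℝ) (V : Sph → E3) :
    lineIntegral γ L (fun x => -V x) = -lineIntegral γ L V := by
  simp only [lineIntegral, inner_neg_left, neg_mul, intervalIntegral.integral_neg]

lemma lineIntegral_congr {γ : ℝ → Sph} {L : ℝ} {V W : Sph → E3} (h : EqOn V W (range γ)) :
    lineIntegral γ L V = lineIntegral γ L W := by
  simp only [lineIntegral, h (mem_range_self _)]

lemma integral_laplaceBeltrami_eq_zero {v : Sph → ℝ} (hv : IsC2On v univ) :
    ∫ x, laplaceBeltrami v x ∂area = 0 := by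
  obtain ⟨hdiv, heq⟩ := isDivField_of_eqOn_surfGrad isOpen_univ hv
    hv.continuous_surfGrad.continuousOn (fun _ _ => rfl)
    (integrable_area_of_continuous hv.continuous_laplaceBeltrami).integrableOn
  rw [← integral_surfDiv_eq_zero hdiv]
  exact integral_congr_ae (Eventually.of_forall fun x => (heq (mem_univ x)).symm)

namespace Divides

variable {γ : ℝ → Sph} {L : ℝ} {S₁ S₂ : Set Sph}

theorem setIntegral_mul_surfDiv_add_inner (hS : Divides γ S₁ S₂) (hγ : IsSimpleClosedCurve γ L)
    (hor : PositivelyOriented γ S₂) {φ : Sph → ℝ} {f : Sph → E3} (hφ : IsC1UpToBoundary φ S₂)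
    (hf : IsDivField f S₂) :
    ∫ x in S₂, (φ x * surfDiv f x + ⟪surfGrad φ x, f x⟫) ∂area =
      lineIntegral γ L fun x => φ x • cross x (f x) := by
  rw [← setIntegral_congr_fun hS.isOpen₂.measurableSet
    fun x hx => hf.surfDiv_smul hS.isOpen₂ hφ hx,
    hS.integral_surfDiv_eq_lineIntegral hγ hor (hf.smul hS.isOpen₂ hφ)]
  exact congrArg (lineIntegral γ L) (funext fun x => (crossCLM x).map_smul (φ x) (f x))

theorem green_identity (hS : Divides γ S₁ S₂) (hγ : IsSimpleClosedCurve γ L)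
    (hor : PositivelyOriented γ S₂) {u v : Sph → ℝ} (hu2 : IsC2On u S₂)
    (hu1 : IsC1UpToBoundary u S₂) (hΔ : IntegrableOn (laplaceBeltrami u) S₂ area)
    (hv : IsC2On v univ) :
    (∫ x in S₂, u x * laplaceBeltrami v x ∂area) - ∫ x in S₂, v x * laplaceBeltrami u x ∂area =
      lineIntegral γ L (fun x => v x • boundaryCurl u S₂ x) -
        lineIntegral γ L fun x => u x • surfCurl v x := by
  obtain ⟨G, hGc, hG⟩ := hu1.exists_grad
  have hv1 : IsC1UpToBoundary v S₂ :=
    .of_contMDiff (contMDiffOn_univ.1 (hv.of_le one_le_two)) S₂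
  have hΔv := hv.continuous_laplaceBeltrami.continuousOn (s := closure S₂)
  have hvgrad := hv.continuous_surfGrad.continuousOn (s := closure S₂)
  have hmeas := hS.isOpen₂.measurableSet
  obtain ⟨hGdiv, hGΔ⟩ := isDivField_of_eqOn_surfGrad hS.isOpen₂ hu2 hGc hG hΔ
  obtain ⟨hvdiv, hvΔ⟩ := isDivField_of_eqOn_surfGrad hS.isOpen₂ (hv.mono (subset_univ _)) hvgrad
    (fun _ _ => rfl) (integrableOn_of_continuousOn_closure hΔv)
  have huΔv : IntegrableOn (fun x => u x * laplaceBeltrami v x) S₂ area :=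
    integrableOn_of_continuousOn_closure (hu1.continuousOn.mul hΔv)
  have hinner : IntegrableOn (fun x => ⟪G x, surfGrad v x⟫) S₂ area :=
    integrableOn_of_continuousOn_closure (hGc.inner hvgrad)
  have huv : ∫ x in S₂, (u x * laplaceBeltrami v x + ⟪G x, surfGrad v x⟫) ∂area =
      lineIntegral γ L fun x => -(u x • surfCurl v x) := by
    rw [setIntegral_congr_fun hmeas fun x hx => by rw [hG hx, ← hvΔ hx],
      hS.setIntegral_mul_surfDiv_add_inner hγ hor hu1 hvdiv]
    simp only [cross_eq_neg_cross _ (surfGrad v _), smul_neg, surfCurl]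
  have hvu : ∫ x in S₂, (v x * laplaceBeltrami u x + ⟪G x, surfGrad v x⟫) ∂area =
      lineIntegral γ L fun x => -(v x • boundaryCurl u S₂ x) := by
    rw [setIntegral_congr_fun hmeas fun x hx => by rw [← hGΔ hx, real_inner_comm],
      hS.setIntegral_mul_surfDiv_add_inner hγ hor hv1 hGdiv]
    refine lineIntegral_congr fun x hx => ?_
    rw [boundaryCurl_eq hGc hG (hS.range_subset_closure hx), cross_eq_neg_cross, smul_neg]
  rw [lineIntegral_neg, integral_add huΔv hinner] at huv
  rw [lineIntegral_neg, integral_add (hΔ.continuousOn_mul_of_subset hv1.continuousOn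
    isClosed_closure.isCompact hmeas subset_closure) hinner] at hvu
  linarith

end Divides

/-! ### Zonal functions -/

/-- The cosine of the angle between `x` and the pole `x₀`. Functions of the form `h ∘ height x₀` are
the zonal functions with pole `x₀`. -/
def height (x₀ x : Sph) : ℝ := ⟪(x : E3), (x₀ : E3)⟫

lemma height_le_one (x₀ x : Sph) : height x₀ x ≤ 1 := by
  simpa only [norm_coe_sph, mul_one, height] using real_inner_le_norm (x : E3) x₀

lemma neg_one_le_height (x₀ x : Sph) : -1 ≤ height x₀ x := by
  simpa only [norm_coe_sph, mul_one, height] using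
    neg_le_of_abs_le (abs_real_inner_le_norm (x : E3) x₀)

lemma height_lt_one {x₀ x : Sph} (h : x ≠ x₀) : height x₀ x < 1 :=
  (height_le_one x₀ x).lt_of_ne fun h1 => h <| Subtype.ext <|
    (inner_eq_one_iff_of_norm_eq_one (norm_coe_sph x) (norm_coe_sph x₀)).1 h1

lemma contMDiff_height {m : WithTop ℕ∞} (x₀ : Sph) :
    ContMDiff (𝓡 2) 𝓘(ℝ, ℝ) m (height x₀) := by
  have : Fact (Module.finrank ℝ E3 = 2 + 1) := ⟨by simp⟩
  exact (contDiff_id.inner ℝ contDiff_const).contMDiff.comp contMDiff_coe_sphere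

lemma continuous_height (x₀ : Sph) : Continuous (height x₀) :=
  (contMDiff_height (m := 0) x₀).continuous

lemma isC2On_comp_height {h : ℝ → ℝ} (hh : ∀ t ≤ 1, ContDiffAt ℝ 2 h t) (x₀ : Sph) :
    IsC2On (fun x => h (height x₀ x)) univ := fun x _ =>
  ((hh _ (height_le_one x₀ x)).comp_contMDiffAt (contMDiff_height x₀ x)).contMDiffWithinAt

lemma contDiffAt_homExt_height {m : WithTop ℕ∞} (x₀ x : Sph) :
    ContDiffAt ℝ m (homExt (height x₀)) x :=
  (contDiffAt_coe_radial (coe_sph_ne_zero x)).inner ℝ contDiffAt_const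

lemma surfGrad_height (x₀ x : Sph) : surfGrad (height x₀) x = x₀ - height x₀ x • (x : E3) := by
  have hx := coe_sph_ne_zero x
  have hext : homExt (height x₀) =ᶠ[𝓝 (x : E3)]
      fun y => ‖y‖ ^ (-1 : ℤ) * innerSL ℝ (x₀ : E3) y := by
    filter_upwards [isOpen_ne.mem_nhds hx] with y hy
    rw [homExt, height, coe_radial hy, real_inner_smul_left, zpow_neg_one, innerSL_apply_apply,
      real_inner_comm]
  have hderiv := ((hasFDerivAt_norm_zpow (-1) hx).mul
    (innerSL ℝ (x₀ : E3)).hasFDerivAt).congr_of_eventuallyEq hext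
  refine ext_inner_right ℝ fun v => ?_
  rw [surfGrad, inner_gradient_left, hderiv.fderiv]
  rw [inner_sub_left, real_inner_smul_left, height, real_inner_comm (x₀ : E3)]
  simp [sub_eq_add_neg]

lemma norm_surfGrad_height_sq (x₀ x : Sph) :
    ‖surfGrad (height x₀) x‖ ^ 2 = 1 - height x₀ x ^ 2 := by
  rw [surfGrad_height, norm_sub_sq_real, norm_smul, real_inner_smul_right, norm_coe_sph,
    norm_coe_sph, real_inner_comm, Real.norm_eq_abs, mul_one, sq_abs, ← height]
  ring

lemma surfDiv_const (v : E3) (x : Sph) : surfDiv (fun _ => v) x = -2 * ⟪(x : E3), v⟫ := by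
  have hpow := hasFDerivAt_norm_zpow (-2) (coe_sph_ne_zero x)
  rw [surfDiv, show fieldExt (fun _ => v) = fun y => ‖y‖ ^ (-2 : ℤ) • v from rfl,
    divergence_smul hpow.differentiableAt (differentiableAt_const v), divergence_const, hpow.fderiv]
  simp

lemma surfDiv_coe (x : Sph) : surfDiv (fun z => (z : E3)) x = 0 := by
  have hpow := hasFDerivAt_norm_zpow (-3) (coe_sph_ne_zero x)
  have hext : fieldExt (fun z => (z : E3)) =ᶠ[𝓝 (x : E3)] fun y => ‖y‖ ^ (-3 : ℤ) • y := by
    filter_upwards [isOpen_ne.mem_nhds (coe_sph_ne_zero x)] with y hy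
    rw [fieldExt, coe_radial hy, smul_smul, ← zpow_sub_one₀ (norm_ne_zero_iff.2 hy)]
    rfl
  rw [surfDiv, divergence_congr hext,
    divergence_smul hpow.differentiableAt differentiableAt_fun_id, hpow.fderiv]
  simp [divergence]

lemma laplaceBeltrami_height (x₀ x : Sph) :
    laplaceBeltrami (height x₀) x = -2 * height x₀ x := by
  have hx := coe_sph_ne_zero x
  have hH : DifferentiableAt ℝ (homExt (height x₀)) x :=
    (contDiffAt_homExt_height x₀ x (m := 1)).differentiableAt one_ne_zero
  have hpow := (hasFDerivAt_norm_zpow (-2) hx).differentiableAt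
  have hconst : DifferentiableAt ℝ (fieldExt fun _ => (x₀ : E3)) x :=
    hpow.smul (differentiableAt_const (x₀ : E3))
  have hcoe : DifferentiableAt ℝ (fieldExt fun z => (z : E3)) x :=
    hpow.smul ((contDiffAt_coe_radial hx (m := 1)).differentiableAt one_ne_zero)
  have hsmul : DifferentiableAt ℝ (fieldExt fun z => height x₀ z • (z : E3)) x := by
    rw [fieldExt_fun_smul]
    exact hH.smul hcoe
  rw [← surfDiv_surfGrad (contDiffAt_homExt_height x₀ x), funext (surfGrad_height x₀), surfDiv,
    show fieldExt (fun z => (x₀ : E3) - height x₀ z • (z : E3)) = fun y =>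
      fieldExt (fun _ => (x₀ : E3)) y - fieldExt (fun z => height x₀ z • (z : E3)) y from
        funext fun _ => smul_sub _ _ _,
    divergence_sub hconst hsmul, ← surfDiv, ← surfDiv, surfDiv_const, surfDiv_smul hH hcoe,
    surfDiv_coe, inner_surfGrad_self hH, ← height]
  ring

lemma surfGrad_comp_height {h : ℝ → ℝ} {h' : ℝ} {x₀ x : Sph}
    (hh : HasDerivAt h h' (height x₀ x)) :
    surfGrad (fun z => h (height x₀ z)) x = h' • surfGrad (height x₀) x :=
  gradient_comp (U := homExt (height x₀)) (by rwa [homExt_coe])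
    ((contDiffAt_homExt_height x₀ x (m := 1)).differentiableAt one_ne_zero)

lemma surfCurl_comp_height {h : ℝ → ℝ} {h' : ℝ} {x₀ x : Sph}
    (hh : HasDerivAt h h' (height x₀ x)) :
    surfCurl (fun z => h (height x₀ z)) x = h' • cross x₀ x := by
  rw [surfCurl, surfGrad_comp_height hh, surfGrad_height]
  simp [cross]

lemma laplaceBeltrami_comp_height {h h' : ℝ → ℝ} {h'' : ℝ} {x₀ x : Sph}
    (hh : ∀ᶠ t in 𝓝 (height x₀ x), HasDerivAt h (h' t) t)
    (hh' : HasDerivAt h' h'' (height x₀ x)) :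
    laplaceBeltrami (fun z => h (height x₀ z)) x =
      h'' * (1 - height x₀ x ^ 2) - 2 * height x₀ x * h' (height x₀ x) := by
  rw [← homExt_coe (height x₀)] at hh hh'
  refine (laplacian_comp (contDiffAt_homExt_height x₀ x) hh hh').trans ?_
  rw [← laplaceBeltrami, ← surfGrad, laplaceBeltrami_height, norm_surfGrad_height_sq, homExt_coe]
  ring

/-! ### The fundamental solution and its regularisation -/

lemma area_real_univ : area.real univ = 4 * Real.pi := by
  have h : (volume : Measure E3).real (Metric.ball 0 1) = Real.pi * 4 / 3 := by
    rw [measureReal_def, EuclideanSpace.volume_ball_fin_three]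
    simp only [ENNReal.ofReal_one, one_pow, one_mul, ENNReal.toReal_ofReal_eq_iff]
    positivity
  rw [area, Measure.toSphere_real_apply_univ, h]
  simp
  ring

lemma area_singleton (x₀ : Sph) : area {x₀} = 0 := by
  obtain ⟨e, he, hx₀e⟩ := exists_orthogonal_unit (x₀ : E3)
  have hne : (ℝ ∙ (x₀ : E3)) ≠ ⊤ := by
    intro h
    obtain ⟨r, rfl⟩ := Submodule.mem_span_singleton.1 (h ▸ Submodule.mem_top : e ∈ ℝ ∙ (x₀ : E3))
    rw [real_inner_smul_right, inner_self_sph, mul_one] at hx₀e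
    simp [hx₀e] at he
  rw [area, Measure.toSphere_apply' _ (measurableSet_singleton x₀)]
  refine mul_eq_zero_of_right _ (measure_mono_null ?_ (Measure.addHaar_submodule volume _ hne))
  rintro _ ⟨r, -, _, ⟨x, rfl, rfl⟩, rfl⟩
  exact Submodule.smul_mem _ _ (Submodule.mem_span_singleton_self _)

lemma ae_height_lt_one (x₀ : Sph) : ∀ᵐ x ∂area, height x₀ x < 1 :=
  (measure_eq_zero_iff_ae_notMem.1 (area_singleton x₀)).mono fun _ hx => height_lt_one hx

lemma hasDerivAt_log_const_sub {b t : ℝ} (h : t < b) :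
    HasDerivAt (fun s => Real.log (b - s)) (-(b - t)⁻¹) t := by
  simpa [neg_div] using ((hasDerivAt_id t).const_sub b).log (sub_pos.2 h).ne'

lemma hasDerivAt_inv_const_sub {b t : ℝ} (h : t < b) :
    HasDerivAt (fun s => (b - s)⁻¹) ((b - t)⁻¹ ^ 2) t := by
  simpa using! ((hasDerivAt_id t).const_sub b).fun_inv (sub_pos.2 h).ne'

lemma contDiffAt_log_const_sub {m : WithTop ℕ∞} {b t : ℝ} (h : t < b) :
    ContDiffAt ℝ m (fun s => Real.log (b - s)) t :=
  (contDiffAt_const.sub contDiffAt_id).log (sub_pos.2 h).ne'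

/-- The regularisation `-(1 / 4π) log (1 + ε - ⟨x, x₀⟩)` of the fundamental solution `fundSol`,
which is its value at `ε = 0`. -/
def regSol (ε : ℝ) (x₀ x : Sph) : ℝ :=
  -(1 / (4 * Real.pi)) * Real.log (1 + ε - height x₀ x)

/-- The approximate identity which the Laplacian of `regSol` brings in, see
`laplaceBeltrami_regSol`. -/
def regKernel (ε : ℝ) (x₀ x : Sph) : ℝ :=
  1 / (4 * Real.pi) * (2 * ε + ε ^ 2) * (1 + ε - height x₀ x)⁻¹ ^ 2

lemma regSol_zero (x₀ : Sph) : regSol 0 x₀ = fun x => fundSol x x₀ := by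
  ext1 x
  rw [regSol, fundSol, add_zero, height]

lemma height_lt_one_add {ε : ℝ} (hε : 0 < ε) (x₀ x : Sph) : height x₀ x < 1 + ε :=
  (height_le_one x₀ x).trans_lt (lt_add_of_pos_right 1 hε)

lemma isC2On_regSol {ε : ℝ} (hε : 0 < ε) (x₀ : Sph) : IsC2On (regSol ε x₀) univ :=
  isC2On_comp_height (h := fun t => -(1 / (4 * Real.pi)) * Real.log (1 + ε - t))
    (fun _ ht => contDiffAt_const.mul (contDiffAt_log_const_sub (by linarith))) x₀

lemma hasDerivAt_regSol_profile {ε t : ℝ} (h : t < 1 + ε) :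
    HasDerivAt (fun s => -(1 / (4 * Real.pi)) * Real.log (1 + ε - s))
      (1 / (4 * Real.pi) * (1 + ε - t)⁻¹) t :=
  ((hasDerivAt_log_const_sub h).const_mul _).congr_deriv (neg_mul_neg _ _)

lemma surfCurl_regSol {ε : ℝ} {x₀ x : Sph} (h : height x₀ x < 1 + ε) :
    surfCurl (regSol ε x₀) x =
      (1 / (4 * Real.pi) * (1 + ε - height x₀ x)⁻¹) • cross x₀ x :=
  surfCurl_comp_height (h := fun s => -(1 / (4 * Real.pi)) * Real.log (1 + ε - s))
    (hasDerivAt_regSol_profile h)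

lemma laplaceBeltrami_regSol {ε : ℝ} {x₀ x : Sph} (h : height x₀ x < 1 + ε) :
    laplaceBeltrami (regSol ε x₀) x = 1 / (4 * Real.pi) - regKernel ε x₀ x := by
  have hne : 1 + ε - height x₀ x ≠ 0 := (sub_pos.2 h).ne'
  refine (laplaceBeltrami_comp_height
    (h := fun s => -(1 / (4 * Real.pi)) * Real.log (1 + ε - s))
    (h' := fun s => 1 / (4 * Real.pi) * (1 + ε - s)⁻¹)
    ((gt_mem_nhds h).mono fun t ht => hasDerivAt_regSol_profile ht)
    ((hasDerivAt_inv_const_sub h).const_mul _)).trans ?_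
  rw [regKernel]
  field_simp
  ring

lemma regKernel_nonneg {ε : ℝ} (hε : 0 ≤ ε) (x₀ x : Sph) : 0 ≤ regKernel ε x₀ x := by
  have := Real.pi_pos
  unfold regKernel
  positivity

lemma continuous_regKernel {ε : ℝ} (hε : 0 < ε) (x₀ : Sph) : Continuous (regKernel ε x₀) :=
  continuous_const.mul ((((continuous_const.sub (continuous_height x₀))).inv₀ fun x =>
    (sub_pos.2 (height_lt_one_add hε x₀ x)).ne').pow 2)

lemma integral_regKernel {ε : ℝ} (hε : 0 < ε) (x₀ : Sph) : ∫ x, regKernel ε x₀ x ∂area = 1 := by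
  have h := integral_laplaceBeltrami_eq_zero (isC2On_regSol hε x₀)
  simp only [laplaceBeltrami_regSol (height_lt_one_add hε x₀ _)] at h
  rw [integral_sub (integrable_const _)
    (integrable_area_of_continuous (continuous_regKernel hε x₀)), integral_const, area_real_univ,
    smul_eq_mul, mul_one_div_cancel (by positivity)] at h
  linarith

lemma exists_pos_forall_height_le {O : Set Sph} (hO : IsOpen O) {x₀ : Sph} (hx₀ : x₀ ∈ O) :
    ∃ m > 0, ∀ x ∉ O, m ≤ 1 - height x₀ x := by
  rcases (Oᶜ).eq_empty_or_nonempty with hempty | hne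
  · exact ⟨1, one_pos, fun x hx => absurd (hempty ▸ hx : x ∈ (∅ : Set Sph)) (notMem_empty x)⟩
  · obtain ⟨z, hz, hmin⟩ := hO.isClosed_compl.isCompact.exists_isMinOn hne
      (continuous_const.sub (continuous_height x₀)).continuousOn
    exact ⟨1 - height x₀ z, sub_pos.2 (height_lt_one fun hzx => hz (hzx ▸ hx₀)), fun x hx =>
      hmin hx⟩

lemma tendstoUniformlyOn_regKernel {O : Set Sph} (hO : IsOpen O) {x₀ : Sph} (hx₀ : x₀ ∈ O) :
    TendstoUniformlyOn (fun ε => regKernel ε x₀) 0 (𝓝[>] 0) Oᶜ := by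
  obtain ⟨m, hm, hle⟩ := exists_pos_forall_height_le hO hx₀
  have hcont : Continuous fun ε : ℝ => 1 / (4 * Real.pi) * (2 * ε + ε ^ 2) * m⁻¹ ^ 2 := by
    fun_prop
  have hlim : Tendsto (fun ε : ℝ => 1 / (4 * Real.pi) * (2 * ε + ε ^ 2) * m⁻¹ ^ 2) (𝓝[>] 0)
      (𝓝 0) := by
    simpa using (hcont.tendsto 0).mono_left nhdsWithin_le_nhds
  rw [Metric.tendstoUniformlyOn_iff]
  intro η hη
  filter_upwards [hlim.eventually (gt_mem_nhds hη), self_mem_nhdsWithin] with ε hεη hε x hx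
  have hε' : 0 < ε := hε
  have hmx : m ≤ 1 + ε - height x₀ x := by linarith [hle x hx]
  rw [Pi.zero_apply, dist_zero_left, Real.norm_of_nonneg (regKernel_nonneg hε'.le x₀ x)]
  refine lt_of_le_of_lt ?_ hεη
  unfold regKernel
  gcongr
  exact inv_nonneg.2 (hm.le.trans hmx)

lemma tendsto_integral_regKernel_mul {x₀ : Sph} {g : Sph → ℝ} (hg : Integrable g area)
    (hc : ContinuousAt g x₀) :
    Tendsto (fun ε => ∫ x, regKernel ε x₀ x * g x ∂area) (𝓝[>] 0) (𝓝 (g x₀)) := by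
  have hpos : ∀ᶠ ε : ℝ in 𝓝[>] 0, 0 < ε := self_mem_nhdsWithin
  refine tendsto_integral_peak_smul_of_integrable_of_tendsto (t := univ) MeasurableSet.univ
    univ_mem (measure_ne_top _ _) (hpos.mono fun ε hε x => regKernel_nonneg hε.le x₀ x)
    (fun O hO hx₀ => tendstoUniformlyOn_regKernel hO hx₀) ?_
    (hpos.mono fun ε hε => (continuous_regKernel hε x₀).aestronglyMeasurable) hg hc
  refine tendsto_const_nhds.congr' (hpos.mono fun ε hε => ?_)
  simp only [setIntegral_univ, integral_regKernel hε]

lemma tendsto_setIntegral_regKernel_mul {S : Set Sph} (hS : IsOpen S) {u : Sph → ℝ}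
    (hu : ContinuousOn u (closure S)) {x₀ : Sph} (hx₀ : x₀ ∉ frontier S) :
    Tendsto (fun ε => ∫ x in S, regKernel ε x₀ x * u x ∂area) (𝓝[>] 0)
      (𝓝 (S.indicator u x₀)) := by
  simp only [← integral_indicator hS.measurableSet, indicator_mul_right]
  exact tendsto_integral_regKernel_mul
    ((integrableOn_of_continuousOn_closure hu).integrable_indicator hS.measurableSet)
    ((hu.mono (interior_subset.trans subset_closure)).continuousAt_indicator hx₀)

lemma integrable_of_tendsto_of_integral_le {α : Type*} [MeasurableSpace α] {μ : Measure α}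
    {F : ℕ → α → ℝ} {f : α → ℝ} {C : ℝ} (hF : ∀ n, Integrable (F n) μ) (hF0 : ∀ n, 0 ≤ F n)
    (hC : ∀ n, ∫ x, F n x ∂μ ≤ C) (hf : ∀ᵐ x ∂μ, Tendsto (fun n => F n x) atTop (𝓝 (f x))) :
    Integrable f μ := by
  have hle : ∀ n, ∫⁻ x, ‖F n x‖ₑ ∂μ ≤ ENNReal.ofReal C := fun n => by
    simp only [fun x => Real.enorm_eq_ofReal (hF0 n x)]
    rw [← ofReal_integral_eq_lintegral_ofReal (hF n) (Eventually.of_forall (hF0 n))]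
    exact ENNReal.ofReal_le_ofReal (hC n)
  refine ⟨aestronglyMeasurable_of_tendsto_ae _ (fun n => (hF n).aestronglyMeasurable) hf, ?_⟩
  calc ∫⁻ x, ‖f x‖ₑ ∂μ = ∫⁻ x, liminf (fun n => ‖F n x‖ₑ) atTop ∂μ :=
        lintegral_congr_ae (hf.mono fun x hx => hx.enorm.liminf_eq.symm)
    _ ≤ liminf (fun n => ∫⁻ x, ‖F n x‖ₑ ∂μ) atTop :=
        lintegral_liminf_le' fun n => (hF n).aestronglyMeasurable.enorm
    _ ≤ ENNReal.ofReal C :=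
        liminf_le_of_frequently_le' (Eventually.of_forall hle).frequently
    _ < ⊤ := ENNReal.ofReal_lt_top

lemma hasDerivAt_mul_one_sub_log {b t : ℝ} (h : t < b) :
    HasDerivAt (fun s => (b - s) * (1 - Real.log (b - s))) (Real.log (b - t)) t := by
  have hne : b - t ≠ 0 := (sub_pos.2 h).ne'
  refine (((hasDerivAt_id t).const_sub b).fun_mul
    ((hasDerivAt_log_const_sub h).const_sub 1)).congr_deriv ?_
  rw [neg_neg, id, mul_inv_cancel₀ hne]
  ring

lemma isC2On_mul_one_sub_log {ε : ℝ} (hε : 0 < ε) (x₀ : Sph) :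
    IsC2On (fun x => (1 + ε - height x₀ x) * (1 - Real.log (1 + ε - height x₀ x))) univ :=
  isC2On_comp_height (h := fun t => (1 + ε - t) * (1 - Real.log (1 + ε - t)))
    (fun _ ht => (contDiffAt_const.sub contDiffAt_id).mul
      (contDiffAt_const.sub (contDiffAt_log_const_sub (by linarith)))) x₀

lemma log_three_sub_log_nonneg {ε : ℝ} (hε : ε ∈ Ioc 0 1) (x₀ x : Sph) :
    0 ≤ Real.log 3 - Real.log (1 + ε - height x₀ x) :=
  sub_nonneg.2 <| Real.log_le_log (sub_pos.2 (height_lt_one_add hε.1 x₀ x))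
    (by linarith [hε.2, neg_one_le_height x₀ x])

/-- The integral of the Laplacian vanishes, which bounds that of the left-hand side. -/
lemma log_three_sub_log_le {ε : ℝ} (hε : ε ∈ Ioc 0 1) (x₀ x : Sph) :
    Real.log 3 - Real.log (1 + ε - height x₀ x) ≤ 2 * Real.log 3 + 2 + 2⁻¹ * laplaceBeltrami
      (fun z => (1 + ε - height x₀ z) * (1 - Real.log (1 + ε - height x₀ z))) x := by
  have hlt := height_lt_one_add hε.1 x₀ x
  rw [laplaceBeltrami_comp_height (h := fun s => (1 + ε - s) * (1 - Real.log (1 + ε - s)))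
    ((gt_mem_nhds hlt).mono fun _ => hasDerivAt_mul_one_sub_log) (hasDerivAt_log_const_sub hlt)]
  have hF := log_three_sub_log_nonneg hε x₀ x
  have ha := sub_pos.2 hlt
  have hle := height_le_one x₀ x
  have hge := neg_one_le_height x₀ x
  set t := height x₀ x
  set a := 1 + ε - t
  have hlog : a - 1 ≤ a * Real.log a := Real.self_sub_one_le_mul_log ha.le
  have hdiv : a⁻¹ * (1 - t ^ 2) ≤ 2 := by
    rw [inv_mul_le_iff₀ ha]
    nlinarith [hε.1]
  have hlog3 : ε * Real.log 3 ≤ Real.log 3 :=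
    mul_le_of_le_one_left (Real.log_nonneg (by norm_num)) hε.2
  have hεF : 0 ≤ ε * (Real.log 3 - Real.log a) := mul_nonneg hε.1.le hF
  linarith

lemma integrable_log_three_sub_log {ε : ℝ} (hε : 0 < ε) (x₀ : Sph) :
    Integrable (fun x => Real.log 3 - Real.log (1 + ε - height x₀ x)) area :=
  integrable_area_of_continuous <| continuous_const.sub <|
    (continuous_const.sub (continuous_height x₀)).log fun x =>
      (sub_pos.2 (height_lt_one_add hε x₀ x)).ne'

lemma integral_log_three_sub_log_le {ε : ℝ} (hε : ε ∈ Ioc 0 1) (x₀ : Sph) :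
    ∫ x, (Real.log 3 - Real.log (1 + ε - height x₀ x)) ∂area ≤
      area.real univ * (2 * Real.log 3 + 2) := by
  have hv := isC2On_mul_one_sub_log hε.1 x₀
  have hΔ := (integrable_area_of_continuous hv.continuous_laplaceBeltrami).const_mul 2⁻¹
  refine (integral_mono (integrable_log_three_sub_log hε.1 x₀) ((integrable_const _).add hΔ)
    (log_three_sub_log_le hε x₀)).trans_eq ?_
  simp only [Pi.add_apply]
  rw [integral_add (integrable_const _) hΔ, integral_const_mul,
    integral_laplaceBeltrami_eq_zero hv, mul_zero, add_zero, integral_const, smul_eq_mul]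

lemma integrable_fundSol (x₀ : Sph) : Integrable (fun x => fundSol x x₀) area := by
  have hε : ∀ n : ℕ, 1 / ((n : ℝ) + 1) ∈ Ioc 0 1 := fun n =>
    ⟨Nat.one_div_pos_of_nat, (div_le_one n.cast_add_one_pos).2 (by simp)⟩
  have hint : Integrable (fun x => Real.log 3 - Real.log (1 - height x₀ x)) area := by
    refine integrable_of_tendsto_of_integral_le
      (fun n => integrable_log_three_sub_log (hε n).1 x₀)
      (fun n => log_three_sub_log_nonneg (hε n) x₀)
      (fun n => integral_log_three_sub_log_le (hε n) x₀) ?_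
    filter_upwards [ae_height_lt_one x₀] with x hx
    have hlim := (tendsto_one_div_add_atTop_nhds_zero_nat (𝕜 := ℝ)).const_add (1 - height x₀ x)
    simp only [add_zero, sub_add_eq_add_sub] at hlim
    exact (hlim.log (sub_pos.2 hx).ne').const_sub _
  refine (((integrable_const (Real.log 3)).sub hint).const_mul (-(1 / (4 * Real.pi)))).congr
    (Eventually.of_forall fun x => ?_)
  simp only [Pi.sub_apply, sub_sub_cancel, fundSol, height]

lemma continuousAt_fundSol {x₀ x : Sph} (h : x ≠ x₀) : ContinuousAt (fun x => fundSol x x₀) x :=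
  continuousAt_const.mul <|
    (continuousAt_const.sub (continuous_height x₀).continuousAt).log
      (sub_pos.2 (height_lt_one h)).ne'

lemma integrableOn_fundSol_mul {w : Sph → ℝ} {S : Set Sph} (hS : IsOpen S)
    (hw : IntegrableOn w S area) (hwc : ContinuousOn w S) {x₀ : Sph} (hx₀ : x₀ ∉ frontier S) :
    IntegrableOn (fun x => fundSol x x₀ * w x) S area := by
  obtain ⟨K, hK, hx₀K, hint⟩ : ∃ K : Set Sph, MeasurableSet K ∧ K ∈ 𝓝 x₀ ∧
      IntegrableOn (fun x => fundSol x x₀ * w x) (S ∩ K) area := by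
    by_cases hmem : x₀ ∈ S
    · obtain ⟨K, hK, hx₀K, hKS⟩ := exists_compact_subset hS hmem
      exact ⟨K, hK.measurableSet, mem_interior_iff_mem_nhds.1 hx₀K,
        ((integrable_fundSol x₀).integrableOn.mul_continuousOn (hwc.mono hKS) hK).mono_set
          inter_subset_right⟩
    · have hcl : x₀ ∉ closure S := fun h => hx₀ ⟨h, fun hi => hmem (interior_subset hi)⟩
      exact ⟨Sᶜ, hS.measurableSet.compl, mem_of_superset
        (isClosed_closure.isOpen_compl.mem_nhds hcl) (compl_subset_compl.2 subset_closure), by simp⟩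
  have haway : IntegrableOn (fun x => fundSol x x₀ * w x) (S \ K) area := by
    refine (hw.mono_set sdiff_subset).continuousOn_mul_of_subset (K := (interior K)ᶜ)
      (fun x hx => (continuousAt_fundSol ?_).continuousWithinAt)
      isOpen_interior.isClosed_compl.isCompact (hS.measurableSet.diff hK)
      fun x hx hxi => hx.2 (interior_subset hxi)
    exact fun hxx₀ => hx (hxx₀ ▸ mem_interior_iff_mem_nhds.2 hx₀K)
  exact (inter_union_sdiff S K) ▸ hint.union haway

/-! ### The representation formula -/

lemma norm_regSol_le {ε : ℝ} (hε : ε ∈ Ioc 0 1) {x₀ x : Sph} (h : height x₀ x < 1) :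
    ‖regSol ε x₀ x‖ ≤ ‖fundSol x x₀‖ + 1 / (4 * Real.pi) * Real.log 3 := by
  have hlog3 := sub_nonneg.1 (log_three_sub_log_nonneg hε x₀ x)
  have hlog : Real.log (1 - height x₀ x) ≤ Real.log (1 + ε - height x₀ x) :=
    Real.log_le_log (sub_pos.2 h) (by linarith [hε.1])
  have hle : regSol ε x₀ x ≤ fundSol x x₀ :=
    mul_le_mul_of_nonpos_left hlog (neg_nonpos.2 (by positivity))
  have hge : -(1 / (4 * Real.pi)) * Real.log 3 ≤ regSol ε x₀ x :=
    mul_le_mul_of_nonpos_left hlog3 (neg_nonpos.2 (by positivity))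
  have hC : 0 ≤ 1 / (4 * Real.pi) * Real.log 3 :=
    mul_nonneg (by positivity) (Real.log_nonneg (by norm_num))
  refine (abs_le_max_abs_abs hge hle).trans (max_le ?_ (le_add_of_nonneg_right hC))
  rw [neg_mul, abs_neg, abs_of_nonneg hC]
  exact le_add_of_nonneg_left (norm_nonneg _)

lemma continuous_one_add_sub_height (x₀ : Sph) :
    Continuous fun p : ℝ × Sph => 1 + p.1 - height x₀ p.2 :=
  (continuous_const.add continuous_fst).sub ((continuous_height x₀).comp continuous_snd)

lemma height_lt_one_add_of_notMem {x₀ : Sph} {T : Set Sph} (hx₀ : x₀ ∉ T) {p : ℝ × Sph}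
    (hp : p ∈ Ici (0 : ℝ) ×ˢ T) : height x₀ p.2 < 1 + p.1 :=
  (height_lt_one (ne_of_mem_of_not_mem hp.2 hx₀)).trans_le (le_add_of_nonneg_right hp.1)

lemma continuousAt_regSol {x₀ : Sph} {p : ℝ × Sph} (h : height x₀ p.2 < 1 + p.1) :
    ContinuousAt (fun p : ℝ × Sph => regSol p.1 x₀ p.2) p :=
  continuousAt_const.mul <|
    (continuous_one_add_sub_height x₀).continuousAt.log (sub_pos.2 h).ne'

lemma tendsto_setIntegral_regSol_mul {w : Sph → ℝ} {S : Set Sph} {x₀ : Sph}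
    (hw : IntegrableOn w S area) (hfw : IntegrableOn (fun x => fundSol x x₀ * w x) S area) :
    Tendsto (fun ε => ∫ x in S, regSol ε x₀ x * w x ∂area) (𝓝[>] 0)
      (𝓝 (∫ x in S, fundSol x x₀ * w x ∂area)) := by
  have hε : ∀ᶠ ε : ℝ in 𝓝[>] 0, ε ∈ Ioc 0 1 := Ioc_mem_nhdsGT one_pos
  have hlt := ae_restrict_of_ae (s := S) (ae_height_lt_one x₀)
  refine tendsto_integral_filter_of_dominated_convergence _
    (hε.mono fun ε hε => (continuousOn_univ.1
      (isC2On_regSol hε.1 x₀).continuousOn).aestronglyMeasurable.mul hw.aestronglyMeasurable)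
    (hε.mono fun ε hε => hlt.mono fun x hx => ?_)
    (hfw.norm.add (hw.norm.const_mul (1 / (4 * Real.pi) * Real.log 3)))
    (hlt.mono fun x hx => ?_)
  · rw [norm_mul, Pi.add_apply, norm_mul, ← add_mul]
    exact mul_le_mul_of_nonneg_right (norm_regSol_le hε hx) (norm_nonneg _)
  · have hcont : ContinuousAt (fun ε => regSol ε x₀ x) 0 :=
      ContinuousAt.comp (f := fun ε : ℝ => (ε, x))
        (continuousAt_regSol (hx.trans_eq (add_zero 1).symm)) (by fun_prop)
    rw [← congrFun (regSol_zero x₀) x]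
    exact (hcont.mono_left nhdsWithin_le_nhds).mul_const _

lemma IsC1UpToBoundary.continuousOn_boundaryCurl {u : Sph → ℝ} {S : Set Sph}
    (hu : IsC1UpToBoundary u S) : ContinuousOn (boundaryCurl u S) (closure S) := by
  obtain ⟨G, hGc, hG⟩ := hu.exists_grad
  exact ((crossCLM.continuous.comp_continuousOn hGc).clm_apply
    continuous_subtype_val.continuousOn).congr fun x hx => boundaryCurl_eq hGc hG hx

namespace IsSimpleClosedCurve

variable {γ : ℝ → Sph} {L : ℝ}

lemma tendsto_lineIntegral (hγ : IsSimpleClosedCurve γ L) {V : ℝ → Sph → E3}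
    (hV : ContinuousOn (fun p : ℝ × Sph => V p.1 p.2) (Ici 0 ×ˢ range γ)) :
    Tendsto (fun ε => lineIntegral γ L (V ε)) (𝓝[>] 0) (𝓝 (lineIntegral γ L (V 0))) := by
  have hcont : Continuous fun p : ℝ × ℝ => ⟪V |p.1| (γ p.2), velocity γ p.2⟫ :=
    (hV.comp_continuous (continuous_fst.abs.prodMk (hγ.continuous.comp continuous_snd))
      fun p => ⟨abs_nonneg p.1, mem_range_self p.2⟩).inner
        (hγ.continuous_velocity.comp continuous_snd)
  have hlim := (intervalIntegral.continuous_parametric_intervalIntegral_of_continuous'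
    (μ := volume) (f := fun ε s => ⟪V |ε| (γ s), velocity γ s⟫) hcont 0 L).tendsto 0
  simp only [abs_zero, ← lineIntegral_eq_integral_inner_velocity] at hlim
  refine (hlim.mono_left nhdsWithin_le_nhds).congr' ?_
  filter_upwards [self_mem_nhdsWithin] with ε hε
  rw [abs_of_pos hε]

variable {x₀ : Sph}

lemma tendsto_lineIntegral_regSol_smul (hγ : IsSimpleClosedCurve γ L) (hx₀ : x₀ ∉ range γ)
    {V : Sph → E3} (hV : ContinuousOn V (range γ)) :
    Tendsto (fun ε => lineIntegral γ L fun x => regSol ε x₀ x • V x) (𝓝[>] 0)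
      (𝓝 (lineIntegral γ L fun x => fundSol x x₀ • V x)) := by
  have hcont : ContinuousOn (fun p : ℝ × Sph => regSol p.1 x₀ p.2 • V p.2)
      (Ici 0 ×ˢ range γ) :=
    ContinuousOn.smul
      (fun p hp => (continuousAt_regSol (height_lt_one_add_of_notMem hx₀ hp)).continuousWithinAt)
      (hV.comp continuousOn_snd fun p hp => hp.2)
  simpa only [regSol_zero] using
    hγ.tendsto_lineIntegral (V := fun ε x => regSol ε x₀ x • V x) hcont

lemma tendsto_lineIntegral_smul_surfCurl_regSol (hγ : IsSimpleClosedCurve γ L)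
    (hx₀ : x₀ ∉ range γ) {u : Sph → ℝ} (hu : ContinuousOn u (range γ)) :
    Tendsto (fun ε => lineIntegral γ L fun x => u x • surfCurl (regSol ε x₀) x) (𝓝[>] 0)
      (𝓝 (lineIntegral γ L fun x => u x • surfCurl (fun y => fundSol y x₀) x)) := by
  have hcurl : ContinuousOn (fun p : ℝ × Sph => surfCurl (regSol p.1 x₀) p.2)
      (Ici 0 ×ˢ range γ) :=
    ((continuousOn_const.mul ((continuous_one_add_sub_height x₀).continuousOn.inv₀
      fun p hp => (sub_pos.2 (height_lt_one_add_of_notMem hx₀ hp)).ne')).smul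
        ((crossCLM (x₀ : E3)).continuous.comp
          (continuous_subtype_val.comp continuous_snd)).continuousOn).congr
      fun p hp => surfCurl_regSol (height_lt_one_add_of_notMem hx₀ hp)
  simpa only [regSol_zero] using hγ.tendsto_lineIntegral
    (V := fun ε x => u x • surfCurl (regSol ε x₀) x)
    ((hu.comp continuousOn_snd fun p hp => hp.2).smul hcurl)

end IsSimpleClosedCurve

namespace Divides

variable {γ : ℝ → Sph} {L : ℝ} {S₁ S₂ : Set Sph} {u : Sph → ℝ}

lemma setIntegral_regKernel_mul (hS : Divides γ S₁ S₂) (hγ : IsSimpleClosedCurve γ L)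
    (hor : PositivelyOriented γ S₂) (hu2 : IsC2On u S₂) (hu1 : IsC1UpToBoundary u S₂)
    (hΔ : IntegrableOn (laplaceBeltrami u) S₂ area) {ε : ℝ} (hε : 0 < ε) (x₀ : Sph) :
    ∫ x in S₂, regKernel ε x₀ x * u x ∂area =
      1 / (4 * Real.pi) * (∫ x in S₂, u x ∂area)
        - (∫ x in S₂, regSol ε x₀ x * laplaceBeltrami u x ∂area)
        - lineIntegral γ L (fun x => regSol ε x₀ x • boundaryCurl u S₂ x)
        + lineIntegral γ L (fun x => u x • surfCurl (regSol ε x₀) x) := by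
  have hgreen := hS.green_identity hγ hor hu2 hu1 hΔ (isC2On_regSol hε x₀)
  have hu := integrableOn_of_continuousOn_closure hu1.continuousOn
  have hKu : IntegrableOn (fun x => regKernel ε x₀ x * u x) S₂ area :=
    integrableOn_of_continuousOn_closure
      ((continuous_regKernel hε x₀).continuousOn.mul hu1.continuousOn)
  simp only [laplaceBeltrami_regSol (height_lt_one_add hε x₀ _), mul_comm (u _), sub_mul] at hgreen
  rw [integral_sub (hu.const_mul _) hKu, integral_const_mul] at hgreen
  linarith

theorem reprLHS_eq_indicator (hS : Divides γ S₁ S₂) (hγ : IsSimpleClosedCurve γ L)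
    (hor : PositivelyOriented γ S₂) (hu2 : IsC2On u S₂) (hu1 : IsC1UpToBoundary u S₂)
    (hΔ : IntegrableOn (laplaceBeltrami u) S₂ area) {x₀ : Sph} (hx₀ : x₀ ∉ range γ)
    (hint : IntegrableOn (fun x => fundSol x x₀ * laplaceBeltrami u x) S₂ area) :
    reprLHS γ L S₂ u x₀ = S₂.indicator u x₀ := by
  refine tendsto_nhds_unique ?_ (tendsto_setIntegral_regKernel_mul hS.isOpen₂ hu1.continuousOn
    (hS.frontier₂ ▸ hx₀))
  have hlim := ((tendsto_const_nhds (x := 1 / (4 * Real.pi) * ∫ x in S₂, u x ∂area)).sub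
    (tendsto_setIntegral_regSol_mul hΔ hint)).sub (hγ.tendsto_lineIntegral_regSol_smul hx₀
      (hu1.continuousOn_boundaryCurl.mono hS.range_subset_closure)) |>.add
    (hγ.tendsto_lineIntegral_smul_surfCurl_regSol hx₀
      (hu1.continuousOn.mono hS.range_subset_closure))
  refine hlim.congr' ?_
  filter_upwards [self_mem_nhdsWithin] with ε hε
  exact (hS.setIntegral_regKernel_mul hγ hor hu2 hu1 hΔ hε x₀).symm

end Divides

end SphereRepr

end

theorem mainTheorem1
    (γ : ℝ → SphereRepr.Sph) (L : ℝ) (S₁ S₂ : Set SphereRepr.Sph)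
    (hγ : SphereRepr.IsSimpleClosedCurve γ L)
    (hS : SphereRepr.Divides γ S₁ S₂)
    (hor : SphereRepr.PositivelyOriented γ S₂)
    (u : SphereRepr.Sph → ℝ)
    (hu2 : SphereRepr.IsC2On u S₂)
    (hu1 : SphereRepr.IsC1UpToBoundary u S₂)
    (hΔ : IntegrableOn (SphereRepr.laplaceBeltrami u) S₂ SphereRepr.area)
    (x₀ : SphereRepr.Sph) (hx₀ : x₀ ∉ range γ) :
    IntegrableOn (fun x => SphereRepr.fundSol x x₀ * SphereRepr.laplaceBeltrami u x) S₂
        SphereRepr.area ∧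
      (x₀ ∈ S₂ → SphereRepr.reprLHS γ L S₂ u x₀ = u x₀) ∧
      (x₀ ∈ S₁ → SphereRepr.reprLHS γ L S₂ u x₀ = 0) := by
  have hx₀S₂ : x₀ ∉ frontier S₂ := hS.frontier₂ ▸ hx₀
  have hint := SphereRepr.integrableOn_fundSol_mul hS.isOpen₂ hΔ
    (hu2.continuousOn_laplaceBeltrami hS.isOpen₂) hx₀S₂
  have hrepr := hS.reprLHS_eq_indicator hγ hor hu2 hu1 hΔ hx₀ hint
  exact ⟨hint, fun hmem => hrepr.trans (indicator_of_mem hmem u),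
    fun hmem => hrepr.trans (indicator_of_notMem (hS.disjoint.notMem_of_mem_left hmem) u)⟩
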